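/- Let $P,Q\in\mathbb R[x,y]$ be polynomials, let $\mathbf F=(P,Q)$ and $\mathbf F^\perp=(-Q,P)$. Let $H^2_O([0,1];\mathbb R^2)$ be the Hilbert space of all paths $\mathbf u\in H^2([0,1];\mathbb R^2)$ (square-integrable, with square-integrable weak derivatives $\mathbf u',\mathbf u''$ on $(0,1)$) such that $\mathbf u(0)=\mathbf u(1)$ and $\mathbf u'(0)=\mathbf u'(1)$, with inner product $$\langle\mathbf u,\mathbf v\rangle=\int_0^1(\mathbf u\cdot\mathbf v+\mathbf u'\cdot\mathbf v'+\mathbf u''\cdot\mathbf v'')\,dt$$ and norm $\|\mathbf u\|=\langle\mathbf u,\mathbf u\rangle^{1/2}$, and let $$E_0(\mathbf u)=\frac12\int_0^1\bigl(\mathbf F^\perp(\mathbf u)\cdot\mathbf u'\bigr)^2\,dt .$$ Then, for every constant $K>0$ (which may be taken as small as desired), there is a family $(\mathbf v_\varepsilon)_{\varepsilon>0}$ in $H^2_O([0,1];\mathbb R^2)$ with $\|\mathbf v_\varepsilon\|\to0$ as $\varepsilon\searrow0$ such that, for every $\varepsilon>0$, $\mathbf v_\varepsilon$ extends to a $\mathcal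 C^\infty$ path $\mathbb R\to\mathbb R^2$ of period $1$ which is one-to-one on $[0,1)$, $\|\mathbf v_\varepsilon\|\le K\varepsilon$, and the functional $E_\varepsilon:H^2_O([0,1];\mathbb R^2)\to\mathbb R$, $$E_\varepsilon(\mathbf u)=E_0(\mathbf u)+\frac\varepsilon2\|\mathbf u\|^2+\langle\mathbf u,\mathbf v_\varepsilon\rangle+\frac1{2\varepsilon}\|\mathbf v_\varepsilon\|^2,$$ has the following properties: 1. $E_\varepsilon\ge0$; 2. $E_\varepsilon$ is coercive: $E_\varepsilon(\mathbf u)\to+\infty$ as $\|\mathbf u\|\to\infty$; 3. $E_\varepsilon$ is of class $\mathcal C^2$; 4. $E_\varepsilon$ satisfies the Palais–Smale condition: every sequence $(\mathbf u_j)$ with $E_\varepsilon(\mathbf u_j)$ bounded above and $E_\varepsilon'(\mathbf u_j)\to\mathbf 0$ has a subsequence that converges in norm; 5. every critical point $\mathbf u$ of $E_\varepsilon$ is non-degenerate, i.e. the self-adjoint operator $E_\varepsilon''(\mathbf u)$ on $H^2_O([0,1];\mathbb R^2)$ is invertible; 6. for every $\alpha\in\mathbb R$, the sublevel set $\{E_\varepsilon\le\alpha\}$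 contains only finitely many critical points of $E_\varepsilon$. -/

import Mathlib

open MeasureTheory Set Filter Topology
open scoped ContDiff

noncomputable section

namespace PeriodicPaths

/-- The Euclidean plane. -/
abbrev Plane : Type := EuclideanSpace ℝ (Fin 2)

/-- Lebesgue measure on the open unit interval. -/
abbrev unitMeasure : Measure ℝ := volume.restrict (Ioo (0 : ℝ) 1)

/-- The space `L²([0, 1]; ℝ²)`. -/
abbrev L2Path : Type := Lp Plane 2 unitMeasure

/-- `g` is the weak derivative of `f` on `(0, 1)`: `∫ φ' f = - ∫ φ g` for every smooth `φ` with
compact support in `(0, 1)`. -/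
def IsWeakDeriv (f g : L2Path) : Prop :=
  ∀ φ : ℝ → ℝ, ContDiff ℝ ∞ φ → HasCompactSupport φ → tsupport φ ⊆ Ioo 0 1 →
    ∫ t, deriv φ t • f t ∂unitMeasure = - ∫ t, φ t • g t ∂unitMeasure

/-- The class `f` has a representative `F` which is continuous on `[0, 1]`, with `F 0 = F 1`. -/
def HasEqualEnds (f : L2Path) : Prop :=
  ∃ F : ℝ → Plane, ContinuousOn F (Icc 0 1) ∧ F 0 = F 1 ∧ f =ᵐ[unitMeasure] F

/-! ### Linearity -/

lemma integrable_coe (g : L2Path) : Integrable g unitMeasure :=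
  (Lp.memLp g).integrable (by norm_num)

lemma exists_integral_smul_clm {φ : ℝ → ℝ} (hφ : Continuous φ) {C : ℝ} (hC : ∀ t, ‖φ t‖ ≤ C) :
    ∃ L : L2Path →L[ℝ] Plane, ∀ g : L2Path, L g = ∫ t, φ t • g t ∂unitMeasure := by
  have hint : ∀ g : L2Path, Integrable (fun t => φ t • g t) unitMeasure := fun g =>
    (integrable_coe g).bdd_smul C hφ.aestronglyMeasurable (ae_of_all _ hC)
  have hprob : IsProbabilityMeasure unitMeasure := ⟨by simp⟩
  let L : L2Path →ₗ[ℝ] Plane :=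
    { toFun := fun g => ∫ t, φ t • g t ∂unitMeasure
      map_add' := by
        intro f g
        rw [← integral_add (hint f) (hint g)]
        apply integral_congr_ae
        filter_upwards [Lp.coeFn_add f g] with t ht
        rw [ht, Pi.add_apply, smul_add]
      map_smul' := by
        intro c f
        rw [RingHom.id_apply, ← integral_smul]
        apply integral_congr_ae
        filter_upwards [Lp.coeFn_smul c f] with t ht
        rw [ht, Pi.smul_apply, smul_comm] }
  refine ⟨L.mkContinuous C fun g => ?_, fun g => rfl⟩
  have hC0 : 0 ≤ C := (norm_nonneg _).trans (hC 0)
  have h1 : ∫ t, ‖g t‖ ∂unitMeasure ≤ ‖g‖ := by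
    rw [integral_norm_eq_lintegral_enorm (Lp.aestronglyMeasurable g), Lp.norm_def,
      ← eLpNorm_one_eq_lintegral_enorm]
    exact ENNReal.toReal_mono (Lp.eLpNorm_ne_top g)
      (eLpNorm_le_eLpNorm_of_exponent_le (by norm_num) (Lp.aestronglyMeasurable g))
  calc ‖∫ t, φ t • g t ∂unitMeasure‖ ≤ ∫ t, ‖φ t • g t‖ ∂unitMeasure :=
        norm_integral_le_integral_norm _
    _ ≤ ∫ t, C * ‖g t‖ ∂unitMeasure := by
        apply integral_mono (hint g).norm ((integrable_coe g).norm.const_mul C)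
        intro t
        simp only [norm_smul]
        gcongr
        exact hC t
    _ = C * ∫ t, ‖g t‖ ∂unitMeasure := integral_const_mul _ _
    _ ≤ C * ‖g‖ := by gcongr

lemma exists_test_clm {φ : ℝ → ℝ} (h1 : ContDiff ℝ ∞ φ) (h2 : HasCompactSupport φ) :
    ∃ L M : L2Path →L[ℝ] Plane, (∀ g : L2Path, L g = ∫ t, deriv φ t • g t ∂unitMeasure) ∧
      ∀ g : L2Path, M g = ∫ t, φ t • g t ∂unitMeasure := by
  have hd : Continuous (deriv φ) := h1.continuous_deriv (by simp)
  obtain ⟨C, hC⟩ := h2.deriv.exists_bound_of_continuous hd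
  obtain ⟨D, hD⟩ := h2.exists_bound_of_continuous h1.continuous
  obtain ⟨L, hL⟩ := exists_integral_smul_clm hd hC
  obtain ⟨M, hM⟩ := exists_integral_smul_clm h1.continuous hD
  exact ⟨L, M, hL, hM⟩

lemma IsWeakDeriv.add {f g f' g' : L2Path} (h : IsWeakDeriv f g) (h' : IsWeakDeriv f' g') :
    IsWeakDeriv (f + f') (g + g') := by
  intro φ h1 h2 h3
  obtain ⟨L, M, hL, hM⟩ := exists_test_clm h1 h2
  have e := h φ h1 h2 h3
  have e' := h' φ h1 h2 h3
  rw [← hL, ← hM] at e e' ⊢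
  rw [map_add, map_add, e, e', neg_add]

lemma IsWeakDeriv.smul {f g : L2Path} (c : ℝ) (h : IsWeakDeriv f g) :
    IsWeakDeriv (c • f) (c • g) := by
  intro φ h1 h2 h3
  obtain ⟨L, M, hL, hM⟩ := exists_test_clm h1 h2
  have e := h φ h1 h2 h3
  rw [← hL, ← hM] at e ⊢
  rw [map_smul, map_smul, e, smul_neg]

lemma isWeakDeriv_zero : IsWeakDeriv 0 0 := by
  intro φ h1 h2 h3
  obtain ⟨L, M, hL, hM⟩ := exists_test_clm h1 h2
  rw [← hL, ← hM, map_zero, map_zero, neg_zero]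

lemma HasEqualEnds.add {f g : L2Path} (h : HasEqualEnds f) (h' : HasEqualEnds g) :
    HasEqualEnds (f + g) := by
  obtain ⟨F, h1, h2, h3⟩ := h
  obtain ⟨G, k1, k2, k3⟩ := h'
  refine ⟨F + G, h1.add k1, by simp [h2, k2], ?_⟩
  exact (Lp.coeFn_add f g).trans (h3.add k3)

lemma HasEqualEnds.smul {f : L2Path} (c : ℝ) (h : HasEqualEnds f) : HasEqualEnds (c • f) := by
  obtain ⟨F, h1, h2, h3⟩ := h
  refine ⟨c • F, h1.const_smul c, by simp [h2], ?_⟩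
  exact (Lp.coeFn_smul c f).trans (h3.const_smul c)

lemma hasEqualEnds_zero : HasEqualEnds 0 :=
  ⟨0, continuousOn_const, rfl, Lp.coeFn_zero _ _ _⟩

/-- The space `H²_O([0, 1]; ℝ²)` of the paths `u ∈ H²([0, 1]; ℝ²)` with `u(0) = u(1)` and
`u'(0) = u'(1)`. An element is the triple `(u, u', u'')` of square-integrable functions, and the
inner product is `⟨u, v⟩ = ∫ (u · v + u' · v' + u'' · v'')`. -/
def H2O : Submodule ℝ (PiLp 2 fun _ : Fin 3 => L2Path) where
  carrier := {w | IsWeakDeriv (w 0) (w 1) ∧ IsWeakDeriv (w 1) (w 2) ∧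
    HasEqualEnds (w 0) ∧ HasEqualEnds (w 1)}
  add_mem' := fun ha hb =>
    ⟨ha.1.add hb.1, ha.2.1.add hb.2.1, ha.2.2.1.add hb.2.2.1, ha.2.2.2.add hb.2.2.2⟩
  zero_mem' := ⟨isWeakDeriv_zero, isWeakDeriv_zero, hasEqualEnds_zero, hasEqualEnds_zero⟩
  smul_mem' := fun c _ ha =>
    ⟨ha.1.smul c, ha.2.1.smul c, ha.2.2.1.smul c, ha.2.2.2.smul c⟩

/-! ### Completeness -/

lemma intervalIntegrable_coe (g : L2Path) : IntervalIntegrable g volume 0 1 := by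
  rw [intervalIntegrable_iff_integrableOn_Ioo_of_le zero_le_one]
  exact integrable_coe g

lemma continuousOn_primitive (g : L2Path) :
    ContinuousOn (fun t : ℝ => ∫ s in (0 : ℝ)..t, g s) (Icc 0 1) := by
  have := intervalIntegral.continuousOn_primitive_interval' (intervalIntegrable_coe g)
    (left_mem_uIcc)
  rwa [uIcc_of_le zero_le_one] at this

lemma integral_unit (h : ℝ → Plane) :
    ∫ t, h t ∂unitMeasure = ∫ t in (0 : ℝ)..1, h t := by
  rw [intervalIntegral.integral_of_le zero_le_one, integral_Ioc_eq_integral_Ioo]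

lemma byParts_real {h φ : ℝ → ℝ} (hh : IntervalIntegrable h volume 0 1) (h1 : ContDiff ℝ ∞ φ)
    (h0 : φ 0 = 0) (h1' : φ 1 = 0) :
    ∫ t in (0 : ℝ)..1, deriv φ t * (∫ s in (0 : ℝ)..t, h s) = - ∫ t in (0 : ℝ)..1, φ t * h t := by
  have a1 : AbsolutelyContinuousOnInterval φ 0 1 :=
    ContDiffOn.absolutelyContinuousOnInterval (h1.of_le (by simp)).contDiffOn
  have a2 := hh.absolutelyContinuousOnInterval_intervalIntegral (c := 0) left_mem_uIcc
  have e := a1.integral_mul_deriv_eq_deriv_mul a2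
  have e2 : ∫ t in (0 : ℝ)..1, φ t * deriv (fun x => ∫ s in (0 : ℝ)..x, h s) t
      = ∫ t in (0 : ℝ)..1, φ t * h t := by
    apply intervalIntegral.integral_congr_ae
    filter_upwards [hh.ae_hasDerivAt_integral] with x hx hx'
    rw [(hx (uIoc_subset_uIcc hx') 0 left_mem_uIcc).deriv]
  rw [e2, h0, h1'] at e
  linarith

/-- Integration by parts against a primitive. -/
lemma byParts (g : L2Path) {φ : ℝ → ℝ} (h1 : ContDiff ℝ ∞ φ)
    (h3 : tsupport φ ⊆ Ioo 0 1) :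
    ∫ t, deriv φ t • (∫ s in (0 : ℝ)..t, g s) ∂unitMeasure = - ∫ t, φ t • g t ∂unitMeasure := by
  have hd : Continuous (deriv φ) := h1.continuous_deriv (by simp)
  have h0 : φ 0 = 0 := image_eq_zero_of_notMem_tsupport fun h => by simpa using h3 h
  have h1' : φ 1 = 0 := image_eq_zero_of_notMem_tsupport fun h => by simpa using h3 h
  have hg := intervalIntegrable_coe g
  have i1 : IntervalIntegrable (fun t => deriv φ t • (∫ s in (0 : ℝ)..t, g s)) volume 0 1 := by
    apply ContinuousOn.intervalIntegrable
    rw [uIcc_of_le zero_le_one]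
    exact hd.continuousOn.smul (continuousOn_primitive g)
  have i2 : IntervalIntegrable (fun t => φ t • g t) volume 0 1 :=
    hg.continuousOn_smul h1.continuous.continuousOn
  rw [integral_unit, integral_unit]
  ext i
  have key : ∀ {h : ℝ → Plane} {b : ℝ}, IntervalIntegrable h volume 0 b →
      (∫ t in (0 : ℝ)..b, h t) i = ∫ t in (0 : ℝ)..b, h t i := fun hh =>
    ((EuclideanSpace.proj (𝕜 := ℝ) i).intervalIntegral_comp_comm hh).symm
  have hgi : IntervalIntegrable (fun t => g t i) volume 0 1 :=
    ⟨(EuclideanSpace.proj (𝕜 := ℝ) i).integrable_comp hg.1,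
      (EuclideanSpace.proj (𝕜 := ℝ) i).integrable_comp hg.2⟩
  rw [PiLp.neg_apply, key i1, key i2]
  have e := byParts_real hgi h1 h0 h1'
  simp only [PiLp.smul_apply, smul_eq_mul]
  rw [← e]
  apply intervalIntegral.integral_congr
  intro t ht
  have : IntervalIntegrable g volume 0 t :=
    hg.mono_set (uIcc_subset_uIcc left_mem_uIcc ht)
  simp only [key this]

lemma tsupport_primitive {η : ℝ → ℝ} (h2 : HasCompactSupport η)
    (h3 : tsupport η ⊆ Ioo 0 1) (h0 : ∫ t, η t = 0) :
    HasCompactSupport (fun x => ∫ t in (0 : ℝ)..x, η t) ∧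
      tsupport (fun x => ∫ t in (0 : ℝ)..x, η t) ⊆ Ioo 0 1 := by
  have hK : IsCompact (insert (1 / 2 : ℝ) (tsupport η)) := h2.isCompact.insert _
  have hKs : insert (1 / 2 : ℝ) (tsupport η) ⊆ Ioo 0 1 :=
    insert_subset ⟨by norm_num, by norm_num⟩ h3
  obtain ⟨a, ha, ha'⟩ := hK.exists_isLeast (insert_nonempty _ _)
  obtain ⟨b, hb, hb'⟩ := hK.exists_isGreatest (insert_nonempty _ _)
  have hz : ∀ t, η t ≠ 0 → a ≤ t ∧ t ≤ b := fun t ht =>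
    have : t ∈ insert (1 / 2 : ℝ) (tsupport η) := mem_insert_of_mem _ (subset_tsupport _ ht)
    ⟨ha' this, hb' this⟩
  have hs : Function.support (fun x => ∫ t in (0 : ℝ)..x, η t) ⊆ Icc a b := by
    intro x hx
    by_contra hcon
    apply hx
    rw [mem_Icc, not_and_or, not_le, not_le] at hcon
    rcases hcon with h | h
    · show ∫ t in (0 : ℝ)..x, η t = 0
      rw [intervalIntegral.integral_congr (g := fun _ => 0), intervalIntegral.integral_zero]
      intro t ht
      by_contra hne
      have h1 := (hz t hne).1
      rcases mem_uIcc.1 ht with h5 | h5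
      · linarith
      · linarith [(hKs ha).1]
    · show ∫ t in (0 : ℝ)..x, η t = 0
      rw [intervalIntegral.integral_eq_integral_of_support_subset, h0]
      intro t ht
      exact ⟨(hKs ha).1.trans_le (hz t ht).1, (hz t ht).2.trans h.le⟩
  have ht := closure_minimal hs isClosed_Icc
  exact ⟨isCompact_Icc.of_isClosed_subset (isClosed_tsupport _) ht,
    ht.trans fun x hx => ⟨(hKs ha).1.trans_le hx.1, hx.2.trans_lt (hKs hb).2⟩⟩

/-- A square-integrable function with a weak derivative is a primitive of it, up to a constant. -/
lemma IsWeakDeriv.exists_eq {f g : L2Path} (h : IsWeakDeriv f g) :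
    ∃ c : Plane, f =ᵐ[unitMeasure] fun t => c + ∫ s in (0 : ℝ)..t, g s := by
  set r : ℝ → Plane := fun t => f t - ∫ s in (0 : ℝ)..t, g s with hr
  have iG : Integrable (fun t : ℝ => ∫ s in (0 : ℝ)..t, g s) unitMeasure :=
    ((continuousOn_primitive g).integrableOn_Icc).mono_set Ioo_subset_Icc_self
  have ir : Integrable r unitMeasure := (integrable_coe f).sub iG
  have itest : ∀ {ψ : ℝ → ℝ} {k : ℝ → Plane}, Continuous ψ → HasCompactSupport ψ →
      Integrable k unitMeasure → Integrable (fun t => ψ t • k t) unitMeasure := by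
    intro ψ k h1 h2 hk
    obtain ⟨C, hC⟩ := h2.exists_bound_of_continuous h1
    exact hk.bdd_smul C h1.aestronglyMeasurable (ae_of_all _ hC)
  have hr0 : ∀ φ : ℝ → ℝ, ContDiff ℝ ∞ φ → HasCompactSupport φ → tsupport φ ⊆ Ioo 0 1 →
      ∫ t, deriv φ t • r t ∂unitMeasure = 0 := by
    intro φ h1 h2 h3
    have hd : Continuous (deriv φ) := h1.continuous_deriv (by simp)
    simp only [hr, smul_sub]
    rw [integral_sub (itest hd h2.deriv (integrable_coe f)) (itest hd h2.deriv iG),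
      h φ h1 h2 h3, byParts g h1 h3, sub_self]
  let β : ContDiffBump (1 / 2 : ℝ) := ⟨1 / 8, 1 / 4, by norm_num, by norm_num⟩
  let ρ : ℝ → ℝ := β.normed volume
  have ρ1 : ContDiff ℝ ∞ ρ := β.contDiff_normed
  have ρ2 : HasCompactSupport ρ := β.hasCompactSupport_normed
  have ρ3 : tsupport ρ ⊆ Ioo 0 1 := by
    rw [show tsupport ρ = _ from β.tsupport_normed_eq, Real.closedBall_eq_Icc]
    intro x hx
    have e : β.rOut = 1 / 4 := rfl
    rw [e] at hx
    exact ⟨by linarith [hx.1], by linarith [hx.2]⟩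
  have ρ4 : ∫ t, ρ t = 1 := β.integral_normed
  set c : Plane := ∫ t, ρ t • r t ∂unitMeasure with hc
  have hae : ∀ᵐ x, x ∈ Ioo (0 : ℝ) 1 → r x - c = 0 := by
    have irc : Integrable (fun t => r t - c) unitMeasure := ir.sub (integrable_const c)
    refine isOpen_Ioo.ae_eq_zero_of_integral_contDiff_smul_eq_zero
      (IntegrableOn.locallyIntegrableOn irc) ?_
    intro ψ h1 h2 h3
    have tounit : ∀ {k : ℝ → Plane}, ∫ t, ψ t • k t = ∫ t, ψ t • k t ∂unitMeasure := by
      intro k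
      refine (setIntegral_eq_integral_of_forall_compl_eq_zero fun x hx => ?_).symm
      rw [image_eq_zero_of_notMem_tsupport fun hh => hx (h3 hh), zero_smul]
    have tounit' : ∫ t, ψ t = ∫ t, ψ t ∂unitMeasure := by
      refine (setIntegral_eq_integral_of_forall_compl_eq_zero fun x hx => ?_).symm
      exact image_eq_zero_of_notMem_tsupport fun hh => hx (h3 hh)
    set m : ℝ := ∫ t, ψ t with hm
    let η : ℝ → ℝ := fun t => ψ t - m * ρ t
    have η1 : ContDiff ℝ ∞ η := h1.sub (contDiff_const.mul ρ1)
    have η2 : HasCompactSupport η := h2.sub (ρ2.mul_left (f := fun _ => m))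
    have η3 : tsupport η ⊆ Ioo 0 1 := by
      refine (tsupport_sub ψ (fun t => m * ρ t)).trans (union_subset h3 ?_)
      exact (tsupport_mul_subset_right (f := fun _ => m) (g := ρ)).trans ρ3
    have η0 : ∫ t, η t = 0 := by
      simp only [η]
      rw [integral_sub (h1.continuous.integrable_of_hasCompactSupport h2)
        ((ρ1.continuous.integrable_of_hasCompactSupport ρ2).const_mul m), integral_const_mul, ρ4,
        ← hm]
      ring
    obtain ⟨k2, k3⟩ := tsupport_primitive η2 η3 η0
    have kd : ∀ x, HasDerivAt (fun x => ∫ t in (0 : ℝ)..x, η t) (η x) x := fun x =>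
      intervalIntegral.integral_hasDerivAt_right (η1.continuous.intervalIntegrable _ _)
        (η1.continuous.stronglyMeasurableAtFilter _ _) η1.continuous.continuousAt
    have kd' : deriv (fun x => ∫ t in (0 : ℝ)..x, η t) = η := funext fun x => (kd x).deriv
    have k1 : ContDiff ℝ ∞ (fun x => ∫ t in (0 : ℝ)..x, η t) := by
      rw [contDiff_infty_iff_deriv, kd']
      exact ⟨fun x => (kd x).differentiableAt, η1⟩
    have e := hr0 _ k1 k2 k3
    rw [kd'] at e
    have im : Integrable (fun t => m • ρ t • r t) unitMeasure :=
      (itest ρ1.continuous ρ2 ir).smul m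
    simp only [η, sub_smul, mul_smul] at e
    rw [integral_sub (itest h1.continuous h2 ir) im,
      integral_smul, ← hc] at e
    rw [tounit]
    simp only [smul_sub]
    rw [integral_sub (itest h1.continuous h2 ir)
      (itest h1.continuous h2 (integrable_const c)), integral_smul_const, ← tounit']
    exact e
  refine ⟨c, ?_⟩
  rw [Filter.EventuallyEq, ae_restrict_iff' measurableSet_Ioo]
  filter_upwards [hae] with t ht ht'
  have := ht ht'
  simp only [hr] at this
  rw [sub_sub, sub_eq_zero] at this
  rw [this, add_comm]

lemma IsWeakDeriv.hasEqualEnds_iff {f g : L2Path} (h : IsWeakDeriv f g) :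
    HasEqualEnds f ↔ ∫ t, g t ∂unitMeasure = 0 := by
  obtain ⟨c, hc⟩ := h.exists_eq
  have hcont : ContinuousOn (fun t => c + ∫ s in (0 : ℝ)..t, g s) (Icc 0 1) :=
    continuousOn_const.add (continuousOn_primitive g)
  rw [integral_unit]
  constructor
  · rintro ⟨F, h1, h2, h3⟩
    have e : F =ᵐ[volume.restrict (Icc 0 1)] fun t => c + ∫ s in (0 : ℝ)..t, g s := by
      rw [← restrict_Ioo_eq_restrict_Icc]
      exact h3.symm.trans hc
    have e' := Measure.eqOn_Icc_of_ae_eq volume zero_ne_one e h1 hcont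
    have e0 := e' (left_mem_Icc.2 zero_le_one)
    have e1 := e' (right_mem_Icc.2 zero_le_one)
    simp only [intervalIntegral.integral_same, add_zero] at e0
    rw [← h2, e0] at e1
    simpa using e1
  · intro h0
    exact ⟨_, hcont, by simp [h0], hc⟩

lemma isClosed_isWeakDeriv (i j : Fin 3) :
    IsClosed {w : PiLp 2 fun _ : Fin 3 => L2Path | IsWeakDeriv (w i) (w j)} := by
  simp only [IsWeakDeriv, ofPred_forall]
  refine isClosed_iInter fun φ => isClosed_iInter fun h1 => isClosed_iInter fun h2 =>
    isClosed_iInter fun h3 => ?_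
  obtain ⟨L, M, hL, hM⟩ := exists_test_clm h1 h2
  simp only [← hL, ← hM]
  exact isClosed_eq (by fun_prop) (by fun_prop)

lemma isClosed_H2O : IsClosed (H2O : Set (PiLp 2 fun _ : Fin 3 => L2Path)) := by
  obtain ⟨L, hL⟩ := exists_integral_smul_clm (φ := fun _ => 1) continuous_const
    (C := 1) (by simp)
  simp only [one_smul] at hL
  have e : (H2O : Set (PiLp 2 fun _ : Fin 3 => L2Path)) =
      {w | IsWeakDeriv (w 0) (w 1)} ∩ {w | IsWeakDeriv (w 1) (w 2)} ∩
        ({w | L (w 1) = 0} ∩ {w | L (w 2) = 0}) := by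
    ext w
    simp only [mem_inter_iff, mem_ofPred_eq, hL]
    constructor
    · rintro ⟨h1, h2, h3, h4⟩
      exact ⟨⟨h1, h2⟩, h1.hasEqualEnds_iff.1 h3, h2.hasEqualEnds_iff.1 h4⟩
    · rintro ⟨⟨h1, h2⟩, h3, h4⟩
      exact ⟨h1, h2, h1.hasEqualEnds_iff.2 h3, h2.hasEqualEnds_iff.2 h4⟩
  rw [e]
  exact ((isClosed_isWeakDeriv 0 1).inter (isClosed_isWeakDeriv 1 2)).inter
    ((isClosed_eq (by fun_prop) continuous_const).inter
      (isClosed_eq (by fun_prop) continuous_const))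

instance : CompleteSpace H2O := isClosed_H2O.completeSpace_coe

/-! ### Functionals on a Hilbert space -/

section Functionals

variable {H : Type*} [NormedAddCommGroup H] [InnerProductSpace ℝ H]

/-- `E(u) → +∞` as `‖u‖ → ∞`. -/
def IsCoercive (E : H → ℝ) : Prop := Tendsto E (Bornology.cobounded H) atTop

variable [CompleteSpace H]

/-- The critical points of `E`: the gradient `E'(u)` vanishes. -/
def IsCriticalPoint (E : H → ℝ) (u : H) : Prop := gradient E u = 0

/-- The self-adjoint operator `E''(u) : H → H`, the derivative of the gradient, is invertible. -/
def HasInvertibleHessian (E : H → ℝ) (u : H) : Prop :=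
  (fderiv ℝ (gradient E) u).IsInvertible

/-- The Palais-Smale condition. -/
def PalaisSmale (E : H → ℝ) : Prop :=
  ∀ u : ℕ → H, (∃ C : ℝ, ∀ j, E (u j) ≤ C) →
    Tendsto (fun j => gradient E (u j)) atTop (𝓝 0) →
    ∃ (k : ℕ → ℕ) (w : H), StrictMono k ∧ Tendsto (fun j => u (k j)) atTop (𝓝 w)

end Functionals

/-! ### The functionals of a planar polynomial vector field -/

/-- The rotated vector field `F^⊥ = (-Q, P)`. -/
def perpField (P Q : MvPolynomial (Fin 2) ℝ) (z : Plane) : Plane :=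
  !₂[-(MvPolynomial.eval (fun i => z i) Q), MvPolynomial.eval (fun i => z i) P]

/-- `E₀(u) = ½ ∫₀¹ (F^⊥(u) · u')² dt`. -/
def energyZero (P Q : MvPolynomial (Fin 2) ℝ) (u : H2O) : ℝ :=
  (1 / 2) * ∫ t, (inner ℝ (perpField P Q (u.1 0 t)) (u.1 1 t)) ^ 2 ∂unitMeasure

/-- `E_ε(u) = E₀(u) + (ε/2) ‖u‖² + ⟨u, v⟩ + ‖v‖² / (2 ε)`. -/
def energy (P Q : MvPolynomial (Fin 2) ℝ) (ε : ℝ) (v u : H2O) : ℝ :=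
  energyZero P Q u + ε / 2 * ‖u‖ ^ 2 + inner ℝ u v + 1 / (2 * ε) * ‖v‖ ^ 2

/-- The path `v` is a smooth closed path of period one, one-to-one on a period. -/
def IsSmoothSimpleClosed (v : H2O) : Prop :=
  ∃ γ : ℝ → Plane, ContDiff ℝ ∞ γ ∧ Function.Periodic γ 1 ∧ InjOn γ (Ico 0 1) ∧
    v.1 0 =ᵐ[unitMeasure] γ

end PeriodicPaths

end

/-!
The gradient of the functional is `u ↦ ε u + G u + v`, where `G` is the gradient of the energy
without tilt. That energy factors through the compact embedding `u ↦ (u, u')` of `H²_O` into pairs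
of continuous maps, on which it is smooth; hence `G` is of class `C¹`, maps bounded sets to
relatively compact sets, and has compact derivatives. Completing the square shows that the
functional is nonnegative and coercive, and the compactness of `G` gives the Palais-Smale condition
(`palaisSmale_tiltedEnergy`), whence the finiteness of the critical points in sublevel sets once
all of them are non-degenerate (`PalaisSmale.finite_criticalPoints`).

Non-degeneracy asks that `-v` be a regular value of `Φ = ε + G`. Since smooth paths form a meagre
set, the theorem of Sard and Smale cannot be applied in `H²_O` itself. Instead `v` runs through the
image of a continuous linear map `T` with dense range, from the bounded complex sequences to
`H²_O`: `T w` is the path `∑ 2^{-|n|} w_n e^{2πint}` (`seriesCLM`), which is always smooth, and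
which is one-to-one on a period when `w` is close to a non-zero multiple of the sequence supported at
`n = 1`.

For generic `w`, the point `-T w` is a regular value (`dense_setOf_forall_isInvertible`). Near a
point `u₀`, there is a finite-dimensional space `M` in the range of `T`, with orthogonal projection
`P`, such that `(1 - P) G'(u₀)` has norm less than `ε`. So `Ψ = ε + (1 - P) G` is a local
diffeomorphism, and `Φ ∘ Ψ⁻¹` is the identity plus a map into `M`. It thus preserves every translate
of `M`, and by the finite-dimensional theorem of Sard the critical values of `Φ` near `u₀` meet each
translate in a null set (`exists_nhds_measure_criticalValues_eq_zero`). Compactness of `G` makes the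
set of these values closed; its preimage under `-T` is closed with empty interior, and the theorem
of Baire applies in the space of sequences, as countably many pieces cover `H²_O`.

The density of the range of `T` is the completeness of the Fourier system
(`eq_zero_of_forall_inner_circleH2O`).
-/

noncomputable section

namespace PeriodicPaths

/-! ### The Sard-Smale theorem for compact perturbations of a multiple of the identity -/

section Reduction

variable {H : Type*} [NormedAddCommGroup H] [InnerProductSpace ℝ H]

/-- A compact operator has finite rank up to a small error, and the finite-dimensional space that
captures it may be taken inside any dense subspace. -/
lemma exists_finiteDimensional_norm_sub_starProjection_comp_lt {S : Submodule ℝ H}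
    (hS : Dense (S : Set H)) {C : H →L[ℝ] H} (hC : IsCompactOperator C) {δ : ℝ} (hδ : 0 < δ) :
    ∃ (M : Submodule ℝ H) (_ : FiniteDimensional ℝ M), M ≤ S ∧
      ‖C - M.starProjection ∘L C‖ < δ := by
  obtain ⟨K, hK, hCK⟩ := IsCompactOperator.image_closedBall_subset_compact (f := (C : H →ₗ[ℝ] H))
    hC 1
  obtain ⟨t, htS, htf, ht⟩ := hK.elim_finite_subcover_image (b := (S : Set H))
    (c := fun s => Metric.ball s (δ / 2)) (fun s _ => Metric.isOpen_ball) (by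
      intro x _
      obtain ⟨s, hs, hxs⟩ := hS.exists_dist_lt x (half_pos hδ)
      exact mem_biUnion hs (Metric.mem_ball.2 hxs))
  have := FiniteDimensional.span_of_finite ℝ htf
  refine ⟨Submodule.span ℝ t, this, Submodule.span_le.2 htS, ?_⟩
  refine (ContinuousLinearMap.opNorm_le_of_unit_norm (C := δ / 2) (by positivity) ?_).trans_lt
    (half_lt_self hδ)
  intro x hx
  have hxK : C x ∈ K := hCK ⟨x, by simp [hx], rfl⟩
  obtain ⟨s, hs, hxs⟩ := mem_iUnion₂.1 (ht hxK)
  set M := Submodule.span ℝ t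
  have hsM : M.starProjection s = s :=
    Submodule.starProjection_eq_self_iff.2 (Submodule.subset_span hs)
  have e : (C - M.starProjection ∘L C) x = Mᗮ.starProjection (C x - s) := by
    rw [Submodule.starProjection_orthogonal_val]
    simp only [sub_apply, ContinuousLinearMap.comp_apply, map_sub, hsM]
    abel
  rw [e]
  refine (Submodule.norm_starProjection_apply_le _ _).trans ?_
  rw [← dist_eq_norm]
  exact hxs.le

variable [CompleteSpace H]

lemma isInvertible_smul_id_add {B : H →L[ℝ] H} {ε : ℝ} (hε : 0 < ε) (hB : ‖B‖ < ε) :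
    (ε • ContinuousLinearMap.id ℝ H + B).IsInvertible := by
  have h1 : IsUnit (1 - (-(ε⁻¹ • B))) := by
    apply isUnit_one_sub_of_norm_lt_one
    rw [norm_neg, norm_smul, norm_inv, Real.norm_of_nonneg hε.le, inv_mul_lt_iff₀ hε, mul_one]
    exact hB
  obtain ⟨w, hw⟩ := h1
  have e : ε • ContinuousLinearMap.id ℝ H + B
      = ε • (1 - (-(ε⁻¹ • B))) := by
    rw [sub_neg_eq_add, smul_add, smul_inv_smul₀ hε.ne']
    rfl
  have hu : IsUnit (ε • (1 - (-(ε⁻¹ • B)))) := by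
    rw [← hw]
    exact ((Units.mk0 ε hε.ne') • w).isUnit
  rw [e]
  obtain ⟨w', hw'⟩ := hu
  exact ⟨ContinuousLinearEquiv.unitsEquiv ℝ H w', hw'⟩

/-- A finite-rank perturbation `A + ι B` of an invertible operator `A`, with `B` valued in the
finite-dimensional space `M`, is invertible as soon as its compression `1 + B A⁻¹ ι` to `M` has
non-zero determinant. -/
lemma isInvertible_of_det_ne_zero {M : Submodule ℝ H} [FiniteDimensional ℝ M] (A : H ≃L[ℝ] H)
    (B : H →L[ℝ] M)
    (h : (ContinuousLinearMap.id ℝ M + B ∘L (A.symm : H →L[ℝ] H) ∘L M.subtypeL).det ≠ 0) :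
    ((A : H →L[ℝ] H) + M.subtypeL ∘L B).IsInvertible := by
  set D := ContinuousLinearMap.id ℝ M + B ∘L (A.symm : H →L[ℝ] H) ∘L M.subtypeL
  have hDapp : ∀ m : M, D m = m + B (A.symm m) := fun m => rfl
  have hDinj : Function.Injective D := by
    have := (LinearMap.equivOfDetNeZero (D : M →ₗ[ℝ] M) h).injective
    exact this
  have hDsurj : Function.Surjective D := by
    have := (LinearMap.equivOfDetNeZero (D : M →ₗ[ℝ] M) h).surjective
    exact this
  refine ⟨ContinuousLinearEquiv.ofBijective ((A : H →L[ℝ] H) + M.subtypeL ∘L B) ?_ ?_,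
    ContinuousLinearEquiv.coe_ofBijective _ _ _⟩
  · rw [LinearMap.ker_eq_bot']
    intro v hv
    have hv' : A v + (B v : H) = 0 := hv
    have e : A v = ((-B v : M) : H) := by
      rw [Submodule.coe_neg]
      exact eq_neg_of_add_eq_zero_left hv'
    have e0 : D (-B v) = 0 := by
      rw [hDapp, ← e, A.symm_apply_apply, neg_add_cancel]
    have e1 : -B v = 0 := hDinj (by rw [e0, map_zero])
    rw [e1] at e
    simpa using e
  · rw [LinearMap.range_eq_top]
    intro z
    obtain ⟨m, hm⟩ := hDsurj (-B (A.symm z))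
    refine ⟨A.symm (z + m), ?_⟩
    show A (A.symm (z + m)) + (B (A.symm (z + m)) : H) = z
    rw [hDapp] at hm
    rw [A.apply_symm_apply, map_add, map_add, eq_sub_of_add_eq' hm]
    simp only [Submodule.coe_add, Submodule.coe_sub, Submodule.coe_neg]
    abel

variable {G : H → H} {ε : ℝ}

/-- The local form of the Sard-Smale theorem: near each point, the critical values of `ε + G` meet
every translate of a suitable finite-dimensional space `M` in a Lebesgue null set. After the local
change of variables `u ↦ ε u + (1 - P) G u`, with `P` the orthogonal projection on `M`, the map
becomes the identity plus a map into `M`, and the theorem of Sard applies to its restriction to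
translates of `M`. -/
lemma exists_nhds_measure_criticalValues_eq_zero {S : Submodule ℝ H} (hS : Dense (S : Set H))
    (hε : 0 < ε) (hG : ContDiff ℝ 1 G) (hcomp : ∀ u, IsCompactOperator (fderiv ℝ G u)) (u₀ : H) :
    ∃ (M : Submodule ℝ H) (_ : FiniteDimensional ℝ M), M ≤ S ∧ ∃ U ∈ 𝓝 u₀, ∀ y₀ : H,
      ∀ [MeasurableSpace M] [BorelSpace M] (μ : Measure M) [μ.IsAddHaarMeasure],
        μ {m : M | ∃ u ∈ U, ε • u + G u = y₀ + m ∧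
          ¬ (ε • ContinuousLinearMap.id ℝ H + fderiv ℝ G u).IsInvertible} = 0 := by
  obtain ⟨M, hfin, hMS, hM⟩ :=
    exists_finiteDimensional_norm_sub_starProjection_comp_lt hS (hcomp u₀) hε
  refine ⟨M, hfin, hMS, ?_⟩
  set p : H →L[ℝ] M := M.orthogonalProjectionOnto
  set P : H →L[ℝ] H := M.starProjection
  have hPp : ∀ x, P x = (p x : H) := fun x => Submodule.starProjection_apply _ _
  let Ψ : H → H := fun u => ε • u + (G u - P (G u))
  let B : H → H →L[ℝ] H := fun u => fderiv ℝ G u - P ∘L fderiv ℝ G u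
  have hGd : ∀ u, HasStrictFDerivAt G (fderiv ℝ G u) u := fun u =>
    hG.contDiffAt.hasStrictFDerivAt (by simp)
  have hGc : Continuous (fderiv ℝ G) := hG.continuous_fderiv (by simp)
  have hBc : Continuous B := hGc.sub (continuous_const.clm_comp hGc)
  have hΨ : ∀ u, HasStrictFDerivAt Ψ (ε • ContinuousLinearMap.id ℝ H + B u) u := fun u =>
    ((hasStrictFDerivAt_id u).const_smul ε).add
      ((hGd u).sub (P.hasStrictFDerivAt.comp u (hGd u)))
  obtain ⟨A₀, hA₀⟩ := isInvertible_smul_id_add hε hM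
  have hΨ0 : HasStrictFDerivAt Ψ (A₀ : H →L[ℝ] H) u₀ := by
    rw [hA₀]; exact hΨ u₀
  let e := hΨ0.toOpenPartialHomeomorph Ψ
  have he : ⇑e = Ψ := hΨ0.toOpenPartialHomeomorph_coe
  refine ⟨e.source ∩ {u | ‖B u‖ < ε}, inter_mem
    (e.open_source.mem_nhds hΨ0.mem_toOpenPartialHomeomorph_source)
    ((isOpen_lt hBc.norm continuous_const).mem_nhds hM), ?_⟩
  intro y₀ _ _ μ _
  -- In the coordinates given by `Ψ`, the map `ε + G` restricted to `y₀ + M` becomes `h`, and `s` is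
  -- the set of its degenerate points.
  set s : Set M := {x | ∃ u ∈ e.source ∩ {u | ‖B u‖ < ε}, Ψ u = y₀ + x ∧
    ¬ (ε • ContinuousLinearMap.id ℝ H + fderiv ℝ G u).IsInvertible}
  let h : M → M := fun x => x + p (G (e.symm (y₀ + x)))
  refine measure_mono_null (t := h '' s) ?_ ?_
  · rintro m ⟨u, hu, hum, hinv⟩
    have e1 : Ψ u = y₀ + ((m - p (G u) : M) : H) := by
      rw [Submodule.coe_sub, ← hPp, ← add_sub_assoc, ← hum]
      simp only [Ψ]
      abel
    refine ⟨m - p (G u), ⟨u, hu, e1, hinv⟩, ?_⟩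
    have e2 : e.symm (y₀ + ((m - p (G u) : M) : H)) = u := by
      rw [← e1, ← he]
      exact e.left_inv hu.1
    simp only [h, e2, sub_add_cancel]
  · have key : ∀ x ∈ s, ∃ h' : M →L[ℝ] M, HasFDerivAt h h' x ∧ h'.det = 0 := by
      rintro x ⟨u, hu, hux, hinv⟩
      have eu : e.symm (y₀ + x) = u := by
        rw [← hux, ← he]
        exact e.left_inv hu.1
      have ht : y₀ + (x : H) ∈ e.target := by
        rw [← hux, ← he]
        exact e.map_source hu.1
      obtain ⟨A, hA⟩ := isInvertible_smul_id_add hε hu.2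
      have d1 : HasFDerivAt e.symm (A.symm : H →L[ℝ] H) (y₀ + x) := by
        apply e.hasFDerivAt_symm ht
        rw [he, eu, hA]
        exact (hΨ u).hasFDerivAt
      have d2 : HasFDerivAt (fun x : M => y₀ + (x : H)) M.subtypeL x :=
        M.subtypeL.hasFDerivAt.const_add y₀
      have d3 : HasFDerivAt G (fderiv ℝ G u) (e.symm (y₀ + x)) := by
        rw [eu]; exact (hGd u).hasFDerivAt
      have d4 : HasFDerivAt h (ContinuousLinearMap.id ℝ M +
          (p ∘L fderiv ℝ G u) ∘L (A.symm : H →L[ℝ] H) ∘L M.subtypeL) x := by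
        have := (hasFDerivAt_id x).add
          (p.hasFDerivAt.comp x (d3.comp x (d1.comp x d2)))
        exact this
      refine ⟨_, d4, ?_⟩
      by_contra hdet
      refine hinv ?_
      have := isInvertible_of_det_ne_zero A (p ∘L fderiv ℝ G u) hdet
      convert this using 1
      rw [hA]
      ext v
      simp only [B, add_apply, sub_apply,
        ContinuousLinearMap.comp_apply, hPp, Submodule.subtypeL_apply]
      abel
    choose! h' hh' hdet using key
    exact addHaar_image_eq_zero_of_det_fderivWithin_eq_zero μ
      (fun x hx => (hh' x hx).hasFDerivWithinAt) hdet

/-- The generic form of the Sard-Smale theorem for `ε + G`, along a linear family `T` of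
perturbations with dense range: for a dense set of parameters `w`, all the zeros of
`u ↦ ε u + G u + T w` are non-degenerate. -/
lemma dense_setOf_forall_isInvertible [SecondCountableTopology H] {W : Type*}
    [NormedAddCommGroup W] [NormedSpace ℝ W] [CompleteSpace W] (T : W →L[ℝ] H)
    (hT : DenseRange T)
    (hε : 0 < ε) (hG : ContDiff ℝ 1 G) (hcomp : ∀ u, IsCompactOperator (fderiv ℝ G u))
    (hbdd : ∀ r : ℝ, ∃ K, IsCompact K ∧ G '' Metric.closedBall 0 r ⊆ K) :
    Dense {w : W | ∀ u, ε • u + G u + T w = 0 →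
      (ε • ContinuousLinearMap.id ℝ H + fderiv ℝ G u).IsInvertible} := by
  have hGc : Continuous (fderiv ℝ G) := hG.continuous_fderiv (by simp)
  have hΦc : Continuous fun u => ε • u + G u := by
    have := hG.continuous
    fun_prop
  -- The degenerate points form a closed set.
  set Z : Set H := {u | ¬ (ε • ContinuousLinearMap.id ℝ H + fderiv ℝ G u).IsInvertible} with hZ
  have hZc : IsClosed Z := by
    rw [hZ, ← compl_ofPred, isClosed_compl_iff]
    have : {u | (ε • ContinuousLinearMap.id ℝ H + fderiv ℝ G u).IsInvertible}
        = (fun u => ε • ContinuousLinearMap.id ℝ H + fderiv ℝ G u) ⁻¹'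
          (range ((↑) : (H ≃L[ℝ] H) → H →L[ℝ] H)) := rfl
    rw [this]
    exact ContinuousLinearEquiv.isOpen.preimage (continuous_const.add hGc)
  have hloc := exists_nhds_measure_criticalValues_eq_zero (S := (T : W →ₗ[ℝ] H).range) hT hε hG
    hcomp
  choose M hfin hMS U hU hnull using hloc
  have hball : ∀ u, ∃ r > 0, Metric.closedBall u r ⊆ U u := fun u =>
    Metric.nhds_basis_closedBall.mem_iff.1 (hU u)
  choose r hr hrU using hball
  obtain ⟨c, hc, hcov⟩ := TopologicalSpace.countable_cover_nhds
    (f := fun u => Metric.closedBall u (r u)) (fun u => Metric.closedBall_mem_nhds u (hr u))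
  -- The critical values of each piece of the cover form a closed set.
  have hclosed : ∀ u, IsClosed ((fun u => ε • u + G u) '' (Metric.closedBall u (r u) ∩ Z)) := by
    intro u
    apply IsSeqClosed.isClosed
    intro y y' hy hlim
    choose x hx hxy using hy
    obtain ⟨K, hK, hGK⟩ := hbdd (‖u‖ + r u)
    have hxK : ∀ n, G (x n) ∈ K := by
      intro n
      refine hGK ⟨x n, ?_, rfl⟩
      have h1 := (hx n).1
      rw [mem_closedBall_zero_iff]
      rw [mem_closedBall_iff_norm] at h1
      calc ‖x n‖ = ‖u + (x n - u)‖ := by rw [add_sub_cancel]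
        _ ≤ _ := (norm_add_le _ _).trans (by gcongr)
    obtain ⟨g, _, k, hk, hkg⟩ := hK.tendsto_subseq hxK
    have hxlim : Tendsto (x ∘ k) atTop (𝓝 (ε⁻¹ • (y' - g))) := by
      have e : x ∘ k = fun n => ε⁻¹ • (y (k n) - G (x (k n))) := by
        funext n
        rw [← hxy, add_sub_cancel_right, inv_smul_smul₀ hε.ne', Function.comp_apply]
      rw [e]
      exact ((hlim.comp hk.tendsto_atTop).sub hkg).const_smul _
    refine ⟨_, (Metric.isClosed_closedBall.inter hZc).mem_of_tendsto hxlim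
      (Eventually.of_forall fun n => hx (k n)), ?_⟩
    refine tendsto_nhds_unique ((hΦc.tendsto _).comp hxlim) ?_
    have := hlim.comp hk.tendsto_atTop
    refine this.congr fun n => ?_
    simp only [Function.comp_apply, hxy]
  -- The parameters that avoid the critical values of one piece form a dense open set.
  have hD : ∀ u, IsOpen ((fun w => - T w) ⁻¹'
        ((fun u => ε • u + G u) '' (Metric.closedBall u (r u) ∩ Z)))ᶜ := fun u =>
    ((hclosed u).preimage (by fun_prop)).isOpen_compl
  have hDd : ∀ u, Dense ((fun w => - T w) ⁻¹'
        ((fun u => ε • u + G u) '' (Metric.closedBall u (r u) ∩ Z)))ᶜ := by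
    intro u
    rw [← interior_eq_empty_iff_dense_compl]
    by_contra hne
    obtain ⟨w₀, hw₀⟩ := nonempty_iff_ne_empty.2 hne
    have := hfin u
    obtain ⟨σ, hσ⟩ := LinearMap.exists_rightInverse_of_surjective
      (T : W →ₗ[ℝ] H).rangeRestrict (LinearMap.range_rangeRestrict _)
    let τ : M u →ₗ[ℝ] W := σ ∘ₗ Submodule.inclusion (hMS u)
    have hτ : ∀ m, T (τ m) = m := fun m =>
      congrArg Subtype.val (LinearMap.congr_fun hσ (Submodule.inclusion (hMS u) m))
    have hτc : Continuous τ := τ.continuous_of_finiteDimensional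
    let _ : MeasurableSpace (M u) := borel (M u)
    have : BorelSpace (M u) := ⟨rfl⟩
    -- Otherwise the preimage of the interior under `m ↦ w₀ - τ m`, where `T ∘ τ = id` on `M`, would
    -- be a non-empty open subset of a null set of `M`.
    have hn := hnull u (-T w₀) Measure.addHaar
    have hopen : (fun m : M u => w₀ - τ m) ⁻¹' interior ((fun w => - T w) ⁻¹'
        ((fun u => ε • u + G u) '' (Metric.closedBall u (r u) ∩ Z))) ∈ 𝓝 (0 : M u) := by
      apply (isOpen_interior.preimage (by fun_prop)).mem_nhds
      simpa using hw₀
    refine (Measure.measure_pos_of_mem_nhds (Measure.addHaar : Measure (M u)) hopen).ne' ?_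
    refine measure_mono_null (fun m hm => ?_) hn
    obtain ⟨x, ⟨hx1, hx2⟩, hx3⟩ := interior_subset hm
    refine ⟨x, hrU u hx1, ?_, hx2⟩
    have hx3' : ε • x + G x = -T (w₀ - τ m) := hx3
    rw [hx3', map_sub, hτ]
    abel
  have := hc.to_subtype
  refine (dense_iInter_of_isOpen (fun u : c => hD u) (fun u : c => hDd u)).mono ?_
  intro w hw u hu
  by_contra hinv
  have huc : u ∈ ⋃ x ∈ c, Metric.closedBall x (r x) := by rw [hcov]; trivial
  obtain ⟨x, hxc, hux⟩ := mem_iUnion₂.1 huc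
  refine mem_iInter.1 hw ⟨x, hxc⟩ ⟨u, ⟨hux, hinv⟩, ?_⟩
  exact eq_neg_of_add_eq_zero_left hu

end Reduction

/-! ### Tilted functionals on a Hilbert space -/

section Functional

variable {H : Type*} [NormedAddCommGroup H] [InnerProductSpace ℝ H]
  {X : Type*} [NormedAddCommGroup X] [NormedSpace ℝ X] {J : H →L[ℝ] X} {e : X → ℝ} {ε : ℝ}

/-- The functional `e(J u) + (ε/2) ‖u‖² + ⟨u, v⟩ + ‖v‖² / (2 ε)`. -/
def tiltedEnergy (J : H →L[ℝ] X) (e : X → ℝ) (ε : ℝ) (v u : H) : ℝ :=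
  e (J u) + ε / 2 * ‖u‖ ^ 2 + inner ℝ u v + 1 / (2 * ε) * ‖v‖ ^ 2

lemma tiltedEnergy_eq_add_sq (hε : 0 < ε) (v u : H) :
    tiltedEnergy J e ε v u = e (J u) + ε / 2 * ‖u + ε⁻¹ • v‖ ^ 2 := by
  rw [tiltedEnergy, norm_add_sq_real, norm_smul, inner_smul_right, mul_pow, norm_inv,
    Real.norm_of_nonneg hε.le]
  field_simp
  ring

lemma tiltedEnergy_nonneg (hε : 0 < ε) (hpos : ∀ x, 0 ≤ e x) (v u : H) :
    0 ≤ tiltedEnergy J e ε v u := by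
  rw [tiltedEnergy_eq_add_sq hε]
  have := hpos (J u)
  positivity

lemma norm_le_of_tiltedEnergy_le (hε : 0 < ε) (hpos : ∀ x, 0 ≤ e x) {v u : H} {C : ℝ}
    (h : tiltedEnergy J e ε v u ≤ C) : ‖u‖ ≤ √(2 / ε * C) + ‖ε⁻¹ • v‖ := by
  rw [tiltedEnergy_eq_add_sq hε] at h
  have h0 := hpos (J u)
  have h1 : ‖u + ε⁻¹ • v‖ ≤ √(2 / ε * C) := by
    apply Real.le_sqrt_of_sq_le
    rw [div_mul_eq_mul_div, le_div_iff₀ hε]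
    linarith
  calc ‖u‖ = ‖(u + ε⁻¹ • v) - ε⁻¹ • v‖ := by rw [add_sub_cancel_right]
    _ ≤ _ := (norm_sub_le _ _).trans (by gcongr)

lemma isCoercive_tiltedEnergy (hε : 0 < ε) (hpos : ∀ x, 0 ≤ e x) (v : H) :
    IsCoercive (tiltedEnergy J e ε v) := by
  rw [IsCoercive, tendsto_atTop]
  intro C
  have := (tendsto_norm_cobounded_atTop (E := H)).eventually_gt_atTop
    (√(2 / ε * C) + ‖ε⁻¹ • v‖)
  filter_upwards [this] with u hu
  by_contra! hlt
  exact absurd (norm_le_of_tiltedEnergy_le hε hpos hlt.le) (not_le.2 hu)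

lemma contDiff_tiltedEnergy (he : ContDiff ℝ 2 e) (v : H) :
    ContDiff ℝ 2 (tiltedEnergy J e ε v) := by
  unfold tiltedEnergy
  exact (((he.comp J.contDiff).add (contDiff_const.mul (contDiff_norm_sq ℝ))).add
    (contDiff_id.inner ℝ contDiff_const)).add contDiff_const

variable [CompleteSpace H]

variable (H) in
/-- The Riesz isomorphism of a real Hilbert space, as a linear map from the dual. -/
def rieszCLM : StrongDual ℝ H →L[ℝ] H :=
  LinearMap.mkContinuous
    { toFun := fun l => (InnerProductSpace.toDual ℝ H).symm l
      map_add' := fun a b => map_add _ a b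
      map_smul' := fun c a => by simp } 1 (fun l => by simp)

lemma gradient_eq_rieszCLM (E : H → ℝ) (u : H) : gradient E u = rieszCLM H (fderiv ℝ E u) := rfl

/-- The map `l ↦ l ∘ J`, followed by the Riesz isomorphism. -/
def rieszComp (J : H →L[ℝ] X) : StrongDual ℝ X →L[ℝ] H :=
  rieszCLM H ∘L (ContinuousLinearMap.compL ℝ H X ℝ).flip J

lemma gradient_comp_eq (he : ContDiff ℝ 2 e) :
    gradient (e ∘ J) = fun u => rieszComp J (fderiv ℝ e (J u)) := by
  funext u
  rw [gradient_eq_rieszCLM, fderiv_comp u (he.differentiable (by simp) _) J.differentiableAt,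
    J.fderiv]
  rfl

lemma contDiff_gradient_comp (he : ContDiff ℝ 2 e) : ContDiff ℝ 1 (gradient (e ∘ J)) := by
  rw [gradient_comp_eq he]
  exact (rieszComp J).contDiff.comp ((he.fderiv_right (m := 1) (by norm_num)).comp J.contDiff)

lemma isCompactOperator_fderiv_gradient_comp (hJ : IsCompactOperator J) (he : ContDiff ℝ 2 e)
    (u : H) : IsCompactOperator (fderiv ℝ (gradient (e ∘ J)) u) := by
  have h1 : DifferentiableAt ℝ (fderiv ℝ e) (J u) :=
    (he.fderiv_right (m := 1) (by norm_num)).differentiable (by simp) _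
  have h2 : HasFDerivAt (gradient (e ∘ J))
      (rieszComp J ∘L (fderiv ℝ (fderiv ℝ e) (J u) ∘L J)) u := by
    rw [gradient_comp_eq he]
    exact (rieszComp J).hasFDerivAt.comp u (h1.hasFDerivAt.comp u J.hasFDerivAt)
  rw [h2.fderiv]
  exact (hJ.clm_comp (fderiv ℝ (fderiv ℝ e) (J u))).clm_comp (rieszComp J)

lemma exists_isCompact_gradient_comp_image_subset (hJ : IsCompactOperator J)
    (he : ContDiff ℝ 2 e) (r : ℝ) :
    ∃ K, IsCompact K ∧ gradient (e ∘ J) '' Metric.closedBall 0 r ⊆ K := by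
  obtain ⟨K, hK, hJK⟩ := IsCompactOperator.image_closedBall_subset_compact (f := (J : H →ₗ[ℝ] X))
    hJ r
  have hc : Continuous fun x => rieszComp J (fderiv ℝ e x) :=
    (rieszComp J).continuous.comp (he.continuous_fderiv (by simp))
  refine ⟨_, hK.image hc, ?_⟩
  rintro _ ⟨u, hu, rfl⟩
  rw [gradient_comp_eq he]
  exact ⟨J u, hJK ⟨u, hu, rfl⟩, rfl⟩

lemma gradient_tiltedEnergy (he : ContDiff ℝ 2 e) (v : H) :
    gradient (tiltedEnergy J e ε v) = fun u => ε • u + gradient (e ∘ J) u + v := by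
  funext u
  apply HasGradientAt.gradient
  rw [hasGradientAt_iff_hasFDerivAt]
  have h1 : HasFDerivAt (e ∘ J) (InnerProductSpace.toDual ℝ H (gradient (e ∘ J) u)) u := by
    rw [← hasGradientAt_iff_hasFDerivAt]
    exact (((he.differentiable (by simp)).comp J.differentiable) u).hasGradientAt
  have h2 := (HasStrictFDerivAt.hasFDerivAt (hasStrictFDerivAt_norm_sq u)).const_mul (ε / 2)
  have h3 := (innerSL ℝ v).hasFDerivAt (x := u)
  have h4 := ((h1.add h2).add h3).add_const (1 / (2 * ε) * ‖v‖ ^ 2)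
  have e1 : tiltedEnergy J e ε v = fun x =>
      e (J x) + ε / 2 * ‖x‖ ^ 2 + innerSL ℝ v x + 1 / (2 * ε) * ‖v‖ ^ 2 := by
    funext x
    simp only [tiltedEnergy, innerSL_apply_apply, real_inner_comm]
  rw [e1]
  refine h4.congr_fderiv ?_
  ext x
  simp only [InnerProductSpace.toDual_apply_apply, add_apply, smul_apply, inner_add_left,
    inner_smul_left, innerSL_apply_apply, smul_eq_mul, conj_trivial, nsmul_eq_mul]
  push_cast
  ring

lemma fderiv_gradient_tiltedEnergy (he : ContDiff ℝ 2 e) (v u : H) :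
    fderiv ℝ (gradient (tiltedEnergy J e ε v)) u =
      ε • ContinuousLinearMap.id ℝ H + fderiv ℝ (gradient (e ∘ J)) u := by
  rw [gradient_tiltedEnergy he]
  have h1 : HasFDerivAt (gradient (e ∘ J)) (fderiv ℝ (gradient (e ∘ J)) u) u :=
    ((contDiff_gradient_comp he).differentiable (by simp) u).hasFDerivAt
  exact ((((hasFDerivAt_id u).const_smul ε).add h1).add_const v).fderiv

lemma palaisSmale_tiltedEnergy (hJ : IsCompactOperator J) (he : ContDiff ℝ 2 e)
    (hpos : ∀ x, 0 ≤ e x) (hε : 0 < ε) (v : H) : PalaisSmale (tiltedEnergy J e ε v) := by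
  rintro u ⟨C, hC⟩ hgrad
  obtain ⟨K, hK, hGK⟩ := exists_isCompact_gradient_comp_image_subset hJ he
    (√(2 / ε * C) + ‖ε⁻¹ • v‖)
  have hu : ∀ n, gradient (e ∘ J) (u n) ∈ K := fun n =>
    hGK ⟨u n, mem_closedBall_zero_iff.2 (norm_le_of_tiltedEnergy_le hε hpos (hC n)), rfl⟩
  obtain ⟨g, _, k, hk, hkg⟩ := hK.tendsto_subseq hu
  refine ⟨k, ε⁻¹ • (0 - g - v), hk, ?_⟩
  have e : (fun n => u (k n)) = fun n => ε⁻¹ •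
      (gradient (tiltedEnergy J e ε v) (u (k n)) - gradient (e ∘ J) (u (k n)) - v) := by
    funext n
    rw [gradient_tiltedEnergy he]
    simp only
    rw [add_sub_right_comm, add_sub_cancel_right, add_sub_cancel_right, inv_smul_smul₀ hε.ne']
  rw [e]
  exact (((hgrad.comp hk.tendsto_atTop).sub hkg).sub_const v).const_smul _

/-- Under the Palais-Smale condition, infinitely many critical points in a sublevel set would
accumulate at a critical point, which is degenerate by the inverse function theorem. -/
lemma PalaisSmale.finite_criticalPoints {E : H → ℝ} (hE : ContDiff ℝ 2 E) (hPS : PalaisSmale E)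
    (hnd : ∀ u, IsCriticalPoint E u → HasInvertibleHessian E u) (α : ℝ) :
    {u | IsCriticalPoint E u ∧ E u ≤ α}.Finite := by
  have hg : ContDiff ℝ 1 (gradient E) :=
    (rieszCLM H).contDiff.comp (hE.fderiv_right (m := 1) (by norm_num))
  by_contra hinf
  have hinf' : Set.Infinite {u | IsCriticalPoint E u ∧ E u ≤ α} := hinf
  let u := hinf'.natEmbedding
  have hcrit : ∀ n, gradient E (u n) = 0 := fun n => (u n).2.1
  obtain ⟨k, w, hk, hlim⟩ := hPS (fun n => u n) ⟨α, fun n => (u n).2.2⟩ (by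
    simp only [hcrit]
    exact tendsto_const_nhds)
  have hw : gradient E w = 0 := by
    refine tendsto_nhds_unique ((hg.continuous.tendsto w).comp hlim) ?_
    refine tendsto_const_nhds.congr fun n => ?_
    simp only [Function.comp_apply, hcrit]
  obtain ⟨A, hA⟩ := hnd w hw
  have hstrict : HasStrictFDerivAt (gradient E) (A : H →L[ℝ] H) w := by
    rw [hA]
    exact hg.contDiffAt.hasStrictFDerivAt (by simp)
  have hev := hlim.eventually
    ((hstrict.toOpenPartialHomeomorph (gradient E)).open_source.mem_nhds
      hstrict.mem_toOpenPartialHomeomorph_source)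
  obtain ⟨N, hN⟩ := eventually_atTop.1 hev
  have hinj := (hstrict.toOpenPartialHomeomorph (gradient E)).injOn
  have heq := hinj (hN N le_rfl) (hN (N + 1) (Nat.le_succ N)) (by
    rw [hstrict.toOpenPartialHomeomorph_coe, hcrit, hcrit])
  have := hk.injective (u.injective (Subtype.ext heq))
  omega

/-- For a dense set of parameters `w`, the functional tilted by `T w` has only non-degenerate
critical points. -/
lemma dense_setOf_hasInvertibleHessian_tiltedEnergy [SecondCountableTopology H] {W : Type*}
    [NormedAddCommGroup W] [NormedSpace ℝ W] [CompleteSpace W] (T : W →L[ℝ] H)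
    (hT : DenseRange T) (hJ : IsCompactOperator J) (he : ContDiff ℝ 2 e) (hε : 0 < ε) :
    Dense {w : W | ∀ u, IsCriticalPoint (tiltedEnergy J e ε (T w)) u →
      HasInvertibleHessian (tiltedEnergy J e ε (T w)) u} := by
  refine (dense_setOf_forall_isInvertible T hT hε (contDiff_gradient_comp he)
    (isCompactOperator_fderiv_gradient_comp hJ he)
    (exists_isCompact_gradient_comp_image_subset hJ he)).mono ?_
  intro w hw u hu
  rw [HasInvertibleHessian, fderiv_gradient_tiltedEnergy he]
  rw [IsCriticalPoint, gradient_tiltedEnergy he] at hu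
  exact hw u hu

end Functional

/-! ### Continuous maps on the unit interval -/

/-- The continuous maps from `[0, 1]` to `E`, with the norm of uniform convergence. -/
abbrev UnitMap (E : Type*) [TopologicalSpace E] : Type _ := C(Icc (0 : ℝ) 1, E)

/-- The extension to `ℝ` of a map on `[0, 1]`, constant on both sides. -/
abbrev UnitMap.extend {E : Type*} [TopologicalSpace E] (a : UnitMap E) (t : ℝ) : E :=
  a (projIcc 0 1 zero_le_one t)

lemma UnitMap.continuous_extend {E : Type*} [TopologicalSpace E] (a : UnitMap E) :
    Continuous a.extend :=
  a.continuous.comp continuous_projIcc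

lemma isProbabilityMeasure_unitMeasure : IsProbabilityMeasure unitMeasure := ⟨by simp⟩

lemma isCompactOperator_prodMk {E F F' : Type*} [Zero E] [TopologicalSpace E] [TopologicalSpace F]
    [TopologicalSpace F'] {f : E → F} {g : E → F'} (hf : IsCompactOperator f)
    (hg : IsCompactOperator g) : IsCompactOperator fun x => (f x, g x) := by
  obtain ⟨K, hK, hfK⟩ := hf
  obtain ⟨L, hL, hgL⟩ := hg
  exact ⟨K ×ˢ L, hK.prod hL, inter_mem hfK hgL⟩

section Integral

variable (E : Type*) [NormedAddCommGroup E] [NormedSpace ℝ E]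

lemma UnitMap.integrable_extend {E : Type*} [NormedAddCommGroup E] (a : UnitMap E) :
    Integrable a.extend unitMeasure :=
  ((a.continuous_extend.continuousOn).integrableOn_Icc).mono_set Ioo_subset_Icc_self

/-- The integral over `[0, 1]` of a continuous map. -/
def unitIntegral : UnitMap E →L[ℝ] E :=
  LinearMap.mkContinuous
    { toFun := fun a => ∫ t, a.extend t ∂unitMeasure
      map_add' := fun a b => integral_add a.integrable_extend b.integrable_extend
      map_smul' := fun c a => integral_smul c _ } 1 (fun a => by
      have := isProbabilityMeasure_unitMeasure
      refine (norm_integral_le_of_norm_le_const (C := ‖a‖)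
        (ae_of_all _ fun t => a.norm_coe_le_norm _)).trans ?_
      simp)

lemma unitIntegral_apply (a : UnitMap E) :
    unitIntegral E a = ∫ t, a.extend t ∂unitMeasure := rfl

end Integral

/-! ### Primitives of square-integrable paths -/

/-- Primitives of square-integrable paths are Hölder continuous of exponent `1/2`. -/
lemma norm_intervalIntegral_le_sqrt (g : L2Path) {s t : ℝ} (hs : 0 ≤ s) (hst : s ≤ t)
    (ht : t ≤ 1) : ‖∫ x in s..t, g x‖ ≤ √(t - s) * ‖g‖ := by
  have hle : volume.restrict (Ioc s t) ≤ unitMeasure := by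
    rw [show unitMeasure = _ from restrict_Ioo_eq_restrict_Ioc]
    exact Measure.restrict_mono (Ioc_subset_Ioc hs ht) le_rfl
  have hmeas : AEStronglyMeasurable g (volume.restrict (Ioc s t)) :=
    (Lp.aestronglyMeasurable g).mono_measure hle
  have h1 : eLpNorm g 1 (volume.restrict (Ioc s t)) ≤
      ENNReal.ofReal (√(t - s) * ‖g‖) := by
    refine (eLpNorm_le_eLpNorm_mul_rpow_measure_univ (q := 2) (by norm_num) hmeas).trans ?_
    rw [mul_comm, ENNReal.ofReal_mul (Real.sqrt_nonneg _)]
    gcongr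
    · rw [Measure.restrict_apply_univ, Real.volume_Ioc, Real.sqrt_eq_rpow,
        ← ENNReal.ofReal_rpow_of_nonneg (by linarith) (by norm_num)]
      apply le_of_eq
      congr 1
      norm_num
    · rw [Lp.norm_def, ENNReal.ofReal_toReal (Lp.eLpNorm_ne_top g)]
      exact eLpNorm_mono_measure _ hle
  rw [intervalIntegral.integral_of_le hst]
  refine (norm_integral_le_integral_norm _).trans ?_
  rw [integral_norm_eq_lintegral_enorm hmeas, ← eLpNorm_one_eq_lintegral_enorm]
  exact ENNReal.toReal_le_of_le_ofReal (by positivity) h1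

lemma ae_restrict_uIoc_of_ae {p : ℝ → Prop} (h : ∀ᵐ x ∂unitMeasure, p x) {t : ℝ}
    (ht : t ∈ Icc (0 : ℝ) 1) : ∀ᵐ x ∂volume.restrict (uIoc 0 t), p x := by
  rw [show unitMeasure = _ from restrict_Ioo_eq_restrict_Ioc] at h
  rw [uIoc_of_le ht.1]
  exact ae_mono (Measure.restrict_mono (Ioc_subset_Ioc_right ht.2) le_rfl) h

/-- The primitive `t ↦ ∫₀ᵗ g` of a square-integrable path. -/
def prim : L2Path →L[ℝ] UnitMap Plane :=
  LinearMap.mkContinuous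
    { toFun := fun g => ⟨fun t => ∫ s in (0 : ℝ)..t, g s,
        continuousOn_iff_continuous_domRestrict.1 (continuousOn_primitive g)⟩
      map_add' := by
        intro f g
        ext1 t
        have hint : ∀ g : L2Path, IntervalIntegrable g volume 0 t := fun g =>
          (intervalIntegrable_coe g).mono_set (by
            rw [uIcc_of_le zero_le_one, uIcc_of_le t.2.1]
            exact Icc_subset_Icc_right t.2.2)
        show ∫ s in (0 : ℝ)..t, (f + g : L2Path) s = _
        rw [intervalIntegral.integral_congr_ae_restrict
          (ae_restrict_uIoc_of_ae (Lp.coeFn_add f g) t.2)]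
        exact intervalIntegral.integral_add (hint f) (hint g)
      map_smul' := by
        intro c g
        ext1 t
        show ∫ s in (0 : ℝ)..t, (c • g : L2Path) s = _
        rw [intervalIntegral.integral_congr_ae_restrict
          (ae_restrict_uIoc_of_ae (Lp.coeFn_smul c g) t.2)]
        exact intervalIntegral.integral_smul c _ } 1 (by
    intro g
    rw [one_mul, ContinuousMap.norm_le _ (norm_nonneg g)]
    intro t
    refine (norm_intervalIntegral_le_sqrt g le_rfl t.2.1 t.2.2).trans ?_
    refine mul_le_of_le_one_left (norm_nonneg g) ?_
    rw [sub_zero]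
    exact Real.sqrt_le_one.2 t.2.2)

lemma prim_apply (g : L2Path) (t : Icc (0 : ℝ) 1) : prim g t = ∫ s in (0 : ℝ)..t, g s := rfl

lemma norm_prim_le (g : L2Path) : ‖prim g‖ ≤ ‖g‖ := by
  simpa using prim.le_of_opNorm_le (LinearMap.mkContinuous_norm_le _ zero_le_one _) g

lemma dist_prim_le (g : L2Path) (s t : Icc (0 : ℝ) 1) :
    dist (prim g s) (prim g t) ≤ √(dist s t) * ‖g‖ := by
  wlog hst : (t : ℝ) ≤ s generalizing s t
  · rw [dist_comm, dist_comm s]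
    exact this t s (le_of_not_ge hst)
  have hint : ∀ t : Icc (0 : ℝ) 1, IntervalIntegrable g volume 0 t := fun t =>
    (intervalIntegrable_coe g).mono_set (by
      rw [uIcc_of_le zero_le_one, uIcc_of_le t.2.1]
      exact Icc_subset_Icc_right t.2.2)
  rw [dist_eq_norm, prim_apply, prim_apply,
    intervalIntegral.integral_interval_sub_left (hint s) (hint t), Subtype.dist_eq,
    Real.dist_eq, abs_of_nonneg (by linarith)]
  exact norm_intervalIntegral_le_sqrt g t.2.1 hst s.2.2

/-- Taking primitives is compact, by the theorem of Arzelà and Ascoli. -/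
lemma isCompactOperator_prim : IsCompactOperator prim := by
  have h := isCompactOperator_iff_isCompact_closure_image_closedBall
    (prim : L2Path →ₗ[ℝ] UnitMap Plane) zero_lt_one
  refine h.2 ?_
  let Θ := ContinuousMap.isometryEquivBoundedOfCompact (Icc (0 : ℝ) 1) Plane
  have hA := BoundedContinuousFunction.arzela_ascoli (Metric.closedBall (0 : Plane) 1)
    (isCompact_closedBall _ _) (Θ '' (prim '' Metric.closedBall 0 1)) (by
      rintro _ t ⟨_, ⟨g, hg, rfl⟩, rfl⟩
      rw [mem_closedBall_zero_iff] at hg ⊢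
      exact ((prim g).norm_coe_le_norm t).trans ((norm_prim_le g).trans hg)) (by
      refine Metric.equicontinuous_of_continuity_modulus Real.sqrt ?_ _ ?_
      · simpa using Real.continuous_sqrt.tendsto 0
      · rintro s t ⟨_, _, ⟨g, hg, rfl⟩, rfl⟩
        rw [mem_closedBall_zero_iff] at hg
        exact (dist_prim_le g s t).trans (mul_le_of_le_one_right (Real.sqrt_nonneg _) hg))
  have e : closure (Θ '' (prim '' Metric.closedBall 0 1))
      = Θ '' closure (prim '' Metric.closedBall 0 1) :=
    (Θ.toHomeomorph.image_closure _).symm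
  rw [e] at hA
  exact Θ.toHomeomorph.isCompact_image.1 hA

/-! ### The embedding into the continuously differentiable paths -/

/-- The primitive of `g` with the same mean as `f`. -/
def continuousRep : L2Path × L2Path →L[ℝ] UnitMap Plane :=
  ContinuousLinearMap.const ℝ (Icc (0 : ℝ) 1) ∘L
    (ContinuousMap.evalCLM ℝ (⟨1, right_mem_Icc.2 zero_le_one⟩ : Icc (0 : ℝ) 1) ∘L prim ∘L
        ContinuousLinearMap.fst ℝ L2Path L2Path -
      unitIntegral Plane ∘L prim ∘L ContinuousLinearMap.snd ℝ L2Path L2Path) +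
  prim ∘L ContinuousLinearMap.snd ℝ L2Path L2Path

lemma isCompactOperator_continuousRep : IsCompactOperator continuousRep := by
  refine IsCompactOperator.add ?_ ?_
  · exact (isCompactOperator_of_locallyCompactSpace_rng
      (ContinuousLinearMap.const ℝ (Icc (0 : ℝ) 1) : Plane →L[ℝ] UnitMap Plane)).comp_clm _
  · exact isCompactOperator_prim.comp_clm (ContinuousLinearMap.snd ℝ L2Path L2Path)

lemma IsWeakDeriv.ae_eq_continuousRep {f g : L2Path} (h : IsWeakDeriv f g) :
    f =ᵐ[unitMeasure] (continuousRep (f, g)).extend := by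
  have := isProbabilityMeasure_unitMeasure
  obtain ⟨c, hc⟩ := h.exists_eq
  have hp : ∀ᵐ t ∂unitMeasure, (prim g).extend t = ∫ s in (0 : ℝ)..t, g s := by
    filter_upwards [ae_restrict_mem measurableSet_Ioo] with t ht
    rw [UnitMap.extend, projIcc_of_mem zero_le_one (Ioo_subset_Icc_self ht), prim_apply]
  have hmean : ∫ t in (0 : ℝ)..1, f t = c + unitIntegral Plane (prim g) := by
    rw [← integral_unit, unitIntegral_apply, integral_congr_ae hc, integral_congr_ae hp,
      integral_add (integrable_const c)
        ((continuousOn_primitive g).integrableOn_Icc.mono_set Ioo_subset_Icc_self)]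
    simp
  filter_upwards [hc, hp] with t h1 h2
  rw [h1, ← h2]
  show _ = (∫ t in (0 : ℝ)..1, f t) - unitIntegral Plane (prim g) + (prim g).extend t
  rw [hmean, add_sub_cancel_right]

/-- The component of an element of `H²_O` of the given order of derivation. -/
def component (i : Fin 3) : H2O →L[ℝ] L2Path :=
  PiLp.proj 2 (fun _ : Fin 3 => L2Path) i ∘L H2O.subtypeL

/-- The continuous representative of `u`, for `i = 0`, or of `u'`, for `i = 1`. -/
def pathCLM (i j : Fin 3) : H2O →L[ℝ] UnitMap Plane :=
  continuousRep ∘L (component i).prod (component j)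

/-- The embedding `u ↦ (u, u')` of `H²_O` into pairs of continuous maps. -/
def jetCLM : H2O →L[ℝ] UnitMap Plane × UnitMap Plane :=
  (pathCLM 0 1).prod (pathCLM 1 2)

lemma isCompactOperator_jetCLM : IsCompactOperator jetCLM :=
  isCompactOperator_prodMk
    (isCompactOperator_continuousRep.comp_clm ((component 0).prod (component 1)))
    (isCompactOperator_continuousRep.comp_clm ((component 1).prod (component 2)))

lemma ae_eq_extend_fst_jetCLM (u : H2O) : u.1 0 =ᵐ[unitMeasure] (jetCLM u).1.extend :=
  u.2.1.ae_eq_continuousRep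

lemma ae_eq_extend_snd_jetCLM (u : H2O) : u.1 1 =ᵐ[unitMeasure] (jetCLM u).2.extend :=
  u.2.2.1.ae_eq_continuousRep

/-! ### The energy of a pair of continuous maps -/

/-- The coordinates of a continuous path. -/
def coord (i : Fin 2) : UnitMap Plane →L[ℝ] UnitMap ℝ :=
  (EuclideanSpace.proj (𝕜 := ℝ) i).compLeftContinuous ℝ (Icc (0 : ℝ) 1)

lemma coord_apply (i : Fin 2) (a : UnitMap Plane) (t : Icc (0 : ℝ) 1) :
    coord i a t = a t i := rfl

lemma contDiff_aeval {A F σ : Type*} [NormedCommRing A] [NormedAlgebra ℝ A]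
    [NormedAddCommGroup F] [NormedSpace ℝ F] {n : WithTop ℕ∞} (p : MvPolynomial σ ℝ)
    {c : σ → F → A} (hc : ∀ i, ContDiff ℝ n (c i)) :
    ContDiff ℝ n fun x => MvPolynomial.aeval (fun i => c i x) p := by
  induction p using MvPolynomial.induction_on with
  | C r => simpa using contDiff_const
  | add p q hp hq => simpa using hp.add hq
  | mul_X p i hp => simpa using hp.mul (hc i)

lemma aeval_unitMap_apply {σ : Type*} (p : MvPolynomial σ ℝ) (c : σ → UnitMap ℝ)
    (t : Icc (0 : ℝ) 1) :
    MvPolynomial.aeval c p t = MvPolynomial.eval (fun i => c i t) p := by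
  induction p using MvPolynomial.induction_on with
  | C r => simp
  | add p q hp hq => simp [hp, hq]
  | mul_X p i hp => simp [hp]

/-- The function `F^⊥(a) · b` on `[0, 1]`, for continuous `a` and `b`. -/
def perpPairing (P Q : MvPolynomial (Fin 2) ℝ) (x : UnitMap Plane × UnitMap Plane) : UnitMap ℝ :=
  MvPolynomial.aeval (fun i => coord i x.1) P * coord 1 x.2 -
    MvPolynomial.aeval (fun i => coord i x.1) Q * coord 0 x.2

lemma perpPairing_apply (P Q : MvPolynomial (Fin 2) ℝ) (x : UnitMap Plane × UnitMap Plane)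
    (t : Icc (0 : ℝ) 1) :
    perpPairing P Q x t = inner ℝ (perpField P Q (x.1 t)) (x.2 t) := by
  simp only [perpPairing, ContinuousMap.sub_apply, ContinuousMap.mul_apply, aeval_unitMap_apply,
    coord_apply, perpField, PiLp.inner_apply, Fin.sum_univ_two, RCLike.inner_apply, conj_trivial,
    Matrix.cons_val_zero, Matrix.cons_val_one]
  ring

lemma contDiff_perpPairing (P Q : MvPolynomial (Fin 2) ℝ) {n : WithTop ℕ∞} :
    ContDiff ℝ n (perpPairing P Q) := by
  have h1 : ∀ i, ContDiff ℝ n fun x : UnitMap Plane × UnitMap Plane => coord i x.1 := fun i =>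
    (coord i).contDiff.comp contDiff_fst
  have h2 : ∀ i, ContDiff ℝ n fun x : UnitMap Plane × UnitMap Plane => coord i x.2 := fun i =>
    (coord i).contDiff.comp contDiff_snd
  exact ((contDiff_aeval P h1).mul (h2 1)).sub ((contDiff_aeval Q h1).mul (h2 0))

/-- The functional `½ ∫₀¹ (F^⊥(a) · b)²` of a pair of continuous maps. -/
def jetEnergy (P Q : MvPolynomial (Fin 2) ℝ) (x : UnitMap Plane × UnitMap Plane) : ℝ :=
  1 / 2 * unitIntegral ℝ (perpPairing P Q x ^ 2)

lemma contDiff_jetEnergy (P Q : MvPolynomial (Fin 2) ℝ) {n : WithTop ℕ∞} :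
    ContDiff ℝ n (jetEnergy P Q) :=
  contDiff_const.mul ((unitIntegral ℝ).contDiff.comp ((contDiff_perpPairing P Q).pow 2))

lemma jetEnergy_nonneg (P Q : MvPolynomial (Fin 2) ℝ) (x : UnitMap Plane × UnitMap Plane) :
    0 ≤ jetEnergy P Q x :=
  mul_nonneg (by norm_num) (integral_nonneg fun _ => sq_nonneg _)

lemma energyZero_eq_jetEnergy (P Q : MvPolynomial (Fin 2) ℝ) (u : H2O) :
    energyZero P Q u = jetEnergy P Q (jetCLM u) := by
  rw [energyZero, jetEnergy, unitIntegral_apply]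
  congr 1
  apply integral_congr_ae
  filter_upwards [ae_eq_extend_fst_jetCLM u, ae_eq_extend_snd_jetCLM u] with t h0 h1
  rw [h0, h1]
  exact congrArg (· ^ 2) (perpPairing_apply P Q (jetCLM u) _).symm

lemma energy_eq_tiltedEnergy (P Q : MvPolynomial (Fin 2) ℝ) (ε : ℝ) (v : H2O) :
    energy P Q ε v = tiltedEnergy jetCLM (jetEnergy P Q) ε v := by
  funext u
  rw [energy, tiltedEnergy, energyZero_eq_jetEnergy]

/-! ### Circular paths -/

/-- The identification of the complex numbers with the Euclidean plane. -/
def toPlane : ℂ ≃ₗᵢ[ℝ] Plane := Complex.orthonormalBasisOneI.repr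

/-- The logarithmic derivative `2πin` of the wave `e^{2πint}`. -/
def freq (n : ℤ) : ℂ := 2 * Real.pi * n * Complex.I

/-- The wave `e^{2πint}`. -/
def wave (n : ℤ) (t : ℝ) : ℂ := Complex.exp (freq n * t)

/-- The path `t ↦ z e^{2πint}`, which runs `n` times around a circle. -/
def circlePath (n : ℤ) (z : ℂ) (t : ℝ) : Plane := toPlane (z * wave n t)

lemma freq_sq (n : ℤ) : freq n ^ 2 = ((-(2 * Real.pi * n) ^ 2 : ℝ) : ℂ) := by
  rw [freq, mul_pow, Complex.I_sq]
  push_cast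
  ring

lemma norm_freq (n : ℤ) : ‖freq n‖ = 2 * Real.pi * |(n : ℝ)| := by
  simp [freq, abs_of_pos Real.pi_pos]

lemma norm_wave (n : ℤ) (t : ℝ) : ‖wave n t‖ = 1 := by
  have : freq n * t = ((2 * Real.pi * n * t : ℝ) : ℂ) * Complex.I := by
    rw [freq]
    push_cast
    ring
  rw [wave, this, Complex.norm_exp_ofReal_mul_I]

lemma wave_eq_zpow (n : ℤ) (t : ℝ) : wave n t = wave 1 t ^ n := by
  rw [wave, wave, ← Complex.exp_int_mul]
  congr 1
  simp only [freq]
  push_cast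
  ring

lemma wave_one_eq_iff {s t : ℝ} : wave 1 s = wave 1 t ↔ ∃ k : ℤ, s = t + k := by
  have h : (2 * Real.pi * Complex.I : ℂ) ≠ 0 := Complex.two_pi_I_ne_zero
  rw [wave, wave, Complex.exp_eq_exp_iff_exists_int]
  refine exists_congr fun k => ?_
  have e1 : freq 1 * s = (2 * Real.pi * Complex.I) * (s : ℂ) := by simp [freq]
  have e2 : freq 1 * t + k * (2 * Real.pi * Complex.I)
      = (2 * Real.pi * Complex.I) * ((t + k : ℝ) : ℂ) := by
    simp [freq]; ring
  rw [e1, e2, mul_right_inj' h, Complex.ofReal_inj]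

lemma wave_add_one (n : ℤ) (t : ℝ) : wave n (t + 1) = wave n t := by
  rw [wave_eq_zpow n, wave_eq_zpow n, (wave_one_eq_iff (s := t + 1) (t := t)).2 ⟨1, by simp⟩]

lemma norm_circlePath (n : ℤ) (z : ℂ) (t : ℝ) : ‖circlePath n z t‖ = ‖z‖ := by
  rw [circlePath, LinearIsometryEquiv.norm_map, norm_mul, norm_wave, mul_one]

lemma circlePath_add_one (n : ℤ) (z : ℂ) (t : ℝ) :
    circlePath n z (t + 1) = circlePath n z t := by
  rw [circlePath, circlePath, wave_add_one]

lemma circlePath_one_eq_zero (n : ℤ) (z : ℂ) : circlePath n z 1 = circlePath n z 0 := by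
  simpa using circlePath_add_one n z 0

lemma hasDerivAt_circlePath (n : ℤ) (z : ℂ) (t : ℝ) :
    HasDerivAt (circlePath n z) (circlePath n (freq n * z) t) t := by
  have h1 : HasDerivAt (fun t : ℝ => z * wave n t) (freq n * z * wave n t) t := by
    have h2 : HasDerivAt (fun t : ℝ => freq n * (t : ℂ)) (freq n) t := by
      simpa using (Complex.ofRealCLM.hasDerivAt (x := t)).const_mul (freq n)
    exact ((h2.cexp).const_mul z).congr_deriv (by rw [wave]; ring)
  exact (toPlane : ℂ ≃L[ℝ] Plane).toContinuousLinearMap.hasFDerivAt.comp_hasDerivAt t h1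

lemma deriv_circlePath (n : ℤ) (z : ℂ) :
    deriv (circlePath n z) = circlePath n (freq n * z) :=
  funext fun t => (hasDerivAt_circlePath n z t).deriv

lemma continuous_circlePath (n : ℤ) (z : ℂ) : Continuous (circlePath n z) :=
  continuous_iff_continuousAt.2 fun t => (hasDerivAt_circlePath n z t).continuousAt

lemma iteratedDeriv_circlePath (k : ℕ) (n : ℤ) (z : ℂ) :
    iteratedDeriv k (circlePath n z) = circlePath n (freq n ^ k * z) := by
  induction k with
  | zero => simp
  | succ k ih => rw [iteratedDeriv_succ, ih, deriv_circlePath, pow_succ', mul_assoc]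

lemma contDiff_circlePath (n : ℤ) (z : ℂ) : ContDiff ℝ ∞ (circlePath n z) := by
  refine contDiff_of_differentiable_iteratedDeriv fun k _ => ?_
  rw [iteratedDeriv_circlePath]
  exact fun t => (hasDerivAt_circlePath n _ t).differentiableAt

lemma memLp_circlePath (n : ℤ) (z : ℂ) : MemLp (circlePath n z) 2 unitMeasure :=
  MemLp.of_bound (continuous_circlePath n z).aestronglyMeasurable ‖z‖
    (ae_of_all _ fun t => (norm_circlePath n z t).le)

/-- The class in `L²` of the path `t ↦ z e^{2πint}`, as a function of `z`. -/
def circleL2 (n : ℤ) : ℂ →L[ℝ] L2Path :=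
  LinearMap.mkContinuous
    { toFun := fun z => (memLp_circlePath n z).toLp _
      map_add' := fun z w => by
        rw [← MemLp.toLp_add]
        congr 1
        funext t
        simp only [circlePath, Pi.add_apply, add_mul, map_add]
      map_smul' := fun c z => by
        rw [RingHom.id_apply, ← MemLp.toLp_const_smul]
        congr 1
        funext t
        simp only [circlePath, Pi.smul_apply, smul_mul_assoc, map_smul] } 1 (fun z => by
      refine (Lp.norm_le_of_ae_bound (norm_nonneg z) ?_).trans_eq ?_
      · filter_upwards [(memLp_circlePath n z).coeFn_toLp] with t ht
        exact (congrArg norm ht).trans_le (norm_circlePath n z t).le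
      · simp [measureUnivNNReal])

lemma coeFn_circleL2 (n : ℤ) (z : ℂ) : circleL2 n z =ᵐ[unitMeasure] circlePath n z :=
  (memLp_circlePath n z).coeFn_toLp

lemma norm_circleL2_apply_le (n : ℤ) (z : ℂ) : ‖circleL2 n z‖ ≤ ‖z‖ := by
  simpa using (circleL2 n).le_of_opNorm_le (LinearMap.mkContinuous_norm_le _ zero_le_one _) z

lemma hasEqualEnds_circleL2 (n : ℤ) (z : ℂ) : HasEqualEnds (circleL2 n z) :=
  ⟨circlePath n z, (continuous_circlePath n z).continuousOn, (circlePath_one_eq_zero n z).symm,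
    coeFn_circleL2 n z⟩

lemma isWeakDeriv_circleL2 (n : ℤ) (z : ℂ) :
    IsWeakDeriv (circleL2 n z) (circleL2 n (freq n * z)) := by
  intro φ h1 h2 h3
  have h0 : φ 0 = 0 := image_eq_zero_of_notMem_tsupport fun h => by simpa using h3 h
  have h1' : φ 1 = 0 := image_eq_zero_of_notMem_tsupport fun h => by simpa using h3 h
  have hd : Continuous (deriv φ) := h1.continuous_deriv (by simp)
  have e1 : ∫ t, deriv φ t • circleL2 n z t ∂unitMeasure
      = ∫ t, deriv φ t • circlePath n z t ∂unitMeasure := by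
    apply integral_congr_ae
    filter_upwards [coeFn_circleL2 n z] with t ht
    rw [ht]
  have e2 : ∫ t, φ t • circleL2 n (freq n * z) t ∂unitMeasure
      = ∫ t, φ t • circlePath n (freq n * z) t ∂unitMeasure := by
    apply integral_congr_ae
    filter_upwards [coeFn_circleL2 n (freq n * z)] with t ht
    rw [ht]
  rw [e1, e2, integral_unit, integral_unit, intervalIntegral.integral_smul_deriv_eq_deriv_smul
    (fun t _ => (h1.differentiable (by simp) t).hasDerivAt)
    (fun t _ => hasDerivAt_circlePath n z t) (hd.intervalIntegrable _ _)
    ((continuous_circlePath n _).intervalIntegrable _ _), h0, h1']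
  simp

/-- The path `t ↦ z e^{2πint}` as an element of `H²_O`, as a function of `z`. -/
def circleH2O (n : ℤ) : ℂ →L[ℝ] H2O :=
  ((PiLp.continuousLinearEquiv 2 ℝ fun _ : Fin 3 => L2Path).symm.toContinuousLinearMap ∘L
    ContinuousLinearMap.pi fun i : Fin 3 =>
      circleL2 n ∘L ContinuousLinearMap.mul ℝ ℂ (freq n ^ (i : ℕ))).codRestrict H2O (by
    intro z
    have h1 : IsWeakDeriv (circleL2 n (freq n ^ 0 * z)) (circleL2 n (freq n ^ 1 * z)) := by
      rw [pow_succ', mul_assoc]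
      exact isWeakDeriv_circleL2 n _
    have h2 : IsWeakDeriv (circleL2 n (freq n ^ 1 * z)) (circleL2 n (freq n ^ 2 * z)) := by
      rw [pow_succ' _ 1, mul_assoc]
      exact isWeakDeriv_circleL2 n _
    exact ⟨h1, h2, hasEqualEnds_circleL2 n _, hasEqualEnds_circleL2 n _⟩)

lemma circleH2O_apply (n : ℤ) (z : ℂ) (i : Fin 3) :
    (circleH2O n z).1 i = circleL2 n (freq n ^ (i : ℕ) * z) := rfl

lemma norm_circleH2O_le (n : ℤ) : ‖circleH2O n‖ ≤ 1 + ‖freq n‖ + ‖freq n‖ ^ 2 := by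
  refine ContinuousLinearMap.opNorm_le_bound _ (by positivity) fun z => ?_
  rw [Submodule.coe_norm]
  refine (sq_le_sq₀ (norm_nonneg _) (by positivity)).1 ?_
  have h : ∀ i : Fin 3, ‖(circleH2O n z).1 i‖ ^ 2 ≤ (‖freq n‖ ^ (i : ℕ) * ‖z‖) ^ 2 := by
    intro i
    rw [circleH2O_apply]
    gcongr
    refine (norm_circleL2_apply_le n _).trans ?_
    rw [norm_mul, norm_pow]
  rw [PiLp.norm_sq_eq_of_L2, Fin.sum_univ_three]
  have h0 := h 0
  have h1 := h 1
  have h2 := h 2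
  simp only [Fin.val_zero, Fin.val_one, Fin.val_two, pow_zero, pow_one, one_mul] at h0 h1 h2
  have ha := norm_nonneg z
  have hb := norm_nonneg (freq n)
  have : 0 ≤ ‖z‖ ^ 2 * (2 * ‖freq n‖ + 2 * ‖freq n‖ ^ 2 + 2 * ‖freq n‖ ^ 3) := by positivity
  nlinarith

/-! ### Completeness of the circular paths -/

lemma integral_deriv_mul_add_primitive {h φ : ℝ → ℝ} (hh : IntervalIntegrable h volume 0 1)
    (h0 : ∫ t in (0 : ℝ)..1, h t = 0) (h1 : ContDiff ℝ ∞ φ) (hφ : φ 1 = φ 0) (c : ℝ) :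
    ∫ t in (0 : ℝ)..1, deriv φ t * (c + ∫ s in (0 : ℝ)..t, h s)
      = - ∫ t in (0 : ℝ)..1, φ t * h t := by
  have hd : Continuous (deriv φ) := h1.continuous_deriv (by simp)
  have hprim : ContinuousOn (fun t : ℝ => ∫ s in (0 : ℝ)..t, h s) (uIcc 0 1) :=
    intervalIntegral.continuousOn_primitive_interval' hh left_mem_uIcc
  -- The primitive is tested against `φ - φ 0`, which vanishes at both ends.
  have e := byParts_real hh (h1.sub (contDiff_const (c := φ 0))) (sub_self _) (by simp [hφ])
  have hd' : deriv (fun t => φ t - φ 0) = deriv φ := by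
    funext t
    rw [deriv_sub_const]
  rw [hd'] at e
  simp only [mul_add, sub_mul] at e ⊢
  rw [intervalIntegral.integral_add (f := fun t => deriv φ t * c)
    (g := fun t => deriv φ t * ∫ s in (0 : ℝ)..t, h s)
    ((hd.mul continuous_const).intervalIntegrable _ _)
    (hd.continuousOn.mul hprim).intervalIntegrable, e,
    intervalIntegral.integral_sub (hh.continuousOn_mul h1.continuous.continuousOn)
      (hh.const_mul _), intervalIntegral.integral_const_mul, h0,
    intervalIntegral.integral_mul_const, intervalIntegral.integral_deriv_eq_sub
      (fun t _ => h1.differentiable (by simp) t) (hd.intervalIntegrable _ _), hφ]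
  ring

/-- Integration by parts on the circle: the boundary terms cancel since `f` has equal ends. -/
lemma IsWeakDeriv.inner_circleL2_freq_mul {f g : L2Path} (h : IsWeakDeriv f g)
    (hf : HasEqualEnds f) (n : ℤ) (z : ℂ) :
    inner ℝ (circleL2 n (freq n * z)) f = - inner ℝ (circleL2 n z) g := by
  obtain ⟨c, hc⟩ := h.exists_eq
  have hg0 := h.hasEqualEnds_iff.1 hf
  have hg := intervalIntegrable_coe g
  rw [integral_unit] at hg0
  have key : ∀ {b : ℝ} (i : Fin 2), IntervalIntegrable g volume 0 b →
      (∫ t in (0 : ℝ)..b, g t) i = ∫ t in (0 : ℝ)..b, g t i := fun i hh =>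
    ((EuclideanSpace.proj (𝕜 := ℝ) i).intervalIntegral_comp_comm hh).symm
  have hgi : ∀ i : Fin 2, IntervalIntegrable (fun t => g t i) volume 0 1 := fun i =>
    ⟨(EuclideanSpace.proj (𝕜 := ℝ) i).integrable_comp hg.1,
      (EuclideanSpace.proj (𝕜 := ℝ) i).integrable_comp hg.2⟩
  have hsm : ∀ i : Fin 2, ContDiff ℝ ∞ fun t => circlePath n z t i := fun i =>
    (EuclideanSpace.proj (𝕜 := ℝ) i).contDiff.comp (contDiff_circlePath n z)
  have hder : ∀ i : Fin 2, deriv (fun t => circlePath n z t i)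
      = fun t => circlePath n (freq n * z) t i := fun i => funext fun t =>
    ((EuclideanSpace.proj (𝕜 := ℝ) i).hasFDerivAt.comp_hasDerivAt t
      (hasDerivAt_circlePath n z t)).deriv
  have hcomp : ∀ i : Fin 2, ∫ t in (0 : ℝ)..1, circlePath n (freq n * z) t i *
      (c i + ∫ s in (0 : ℝ)..t, g s i) = - ∫ t in (0 : ℝ)..1, circlePath n z t i * g t i := by
    intro i
    have := integral_deriv_mul_add_primitive (hgi i) (by rw [← key i hg, hg0]; rfl) (hsm i)
      (by rw [circlePath_one_eq_zero]) (c i)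
    rwa [hder] at this
  have hcont : ∀ (z : ℂ) (i : Fin 2), Continuous fun t => circlePath n z t i := fun z i =>
    (EuclideanSpace.proj (𝕜 := ℝ) i).continuous.comp (continuous_circlePath n z)
  have e1 : inner ℝ (circleL2 n (freq n * z)) f = ∫ t in (0 : ℝ)..1,
      ∑ i, circlePath n (freq n * z) t i * (c i + ∫ s in (0 : ℝ)..t, g s i) := by
    rw [L2.inner_def, intervalIntegral.integral_of_le zero_le_one, integral_Ioc_eq_integral_Ioo]
    apply integral_congr_ae
    filter_upwards [coeFn_circleL2 n (freq n * z), hc, ae_restrict_mem measurableSet_Ioo]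
      with t h1 h2 ht
    have hgt : IntervalIntegrable g volume 0 t := hg.mono_set (by
      rw [uIcc_of_le zero_le_one, uIcc_of_le ht.1.le]
      exact Icc_subset_Icc_right ht.2.le)
    rw [h1, h2, PiLp.inner_apply]
    refine Finset.sum_congr rfl fun i _ => ?_
    rw [PiLp.add_apply, key i hgt, RCLike.inner_apply, conj_trivial, mul_comm]
  have e2 : inner ℝ (circleL2 n z) g = ∫ t in (0 : ℝ)..1, ∑ i, circlePath n z t i * g t i := by
    rw [L2.inner_def, intervalIntegral.integral_of_le zero_le_one, integral_Ioc_eq_integral_Ioo]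
    apply integral_congr_ae
    filter_upwards [coeFn_circleL2 n z] with t h1
    rw [h1, PiLp.inner_apply]
    refine Finset.sum_congr rfl fun i _ => ?_
    rw [RCLike.inner_apply, conj_trivial, mul_comm]
  rw [e1, e2, intervalIntegral.integral_finsetSum, intervalIntegral.integral_finsetSum,
    ← Finset.sum_neg_distrib]
  · exact Finset.sum_congr rfl fun i _ => hcomp i
  · exact fun i _ => (hgi i).continuousOn_mul (hcont z i).continuousOn
  · exact fun i _ => ((hcont _ i).continuousOn.mul (continuousOn_const.add
      (intervalIntegral.continuousOn_primitive_interval' (hgi i)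
        left_mem_uIcc))).intervalIntegrable

/-- A path orthogonal in `L²` to all the circular paths vanishes: all its Fourier coefficients are
zero. -/
lemma eq_zero_of_forall_inner_circleL2 {f : L2Path}
    (h : ∀ n z, inner ℝ (circleL2 n z) f = 0) : f = 0 := by
  set F : ℝ → ℂ := fun t => toPlane.symm (f t)
  have hFm : AEStronglyMeasurable F unitMeasure :=
    toPlane.symm.continuous.comp_aestronglyMeasurable (Lp.aestronglyMeasurable f)
  have hFnorm : ∀ t, ‖F t‖ = ‖f t‖ := fun t => toPlane.symm.norm_map _
  have hFLp : MemLp F 2 unitMeasure :=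
    (Lp.memLp f).of_le hFm (ae_of_all _ fun t => (hFnorm t).le)
  have hwc : ∀ n, Continuous (wave n) := fun n => by unfold wave; fun_prop
  have hcoef : ∀ n, ∫ t, starRingEnd ℂ (wave n t) * F t ∂unitMeasure = 0 := by
    intro n
    -- The inner product with the circular path of amplitude `c` is `‖c‖²`.
    set c : ℂ := ∫ t, starRingEnd ℂ (wave n t) * F t ∂unitMeasure
    have hint : Integrable (fun t => starRingEnd ℂ (wave n t) * F t) unitMeasure := by
      refine (hFLp.integrable (by norm_num)).bdd_mul (c := 1)
        (Complex.continuous_conj.comp (hwc n)).aestronglyMeasurable (ae_of_all _ fun t => ?_)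
      rw [RCLike.norm_conj, norm_wave]
    have e1 : inner ℝ (circleL2 n c) f = inner ℝ c c := by
      have e3 : inner ℝ c c = ∫ t, innerSL ℝ c (starRingEnd ℂ (wave n t) * F t) ∂unitMeasure :=
        ((innerSL ℝ c).integral_comp_comm hint).symm
      rw [L2.inner_def, e3]
      apply integral_congr_ae
      filter_upwards [coeFn_circleL2 n c] with t ht
      have e2 : f t = toPlane (F t) := (toPlane.apply_symm_apply _).symm
      rw [ht, e2, circlePath, LinearIsometryEquiv.inner_map_map, innerSL_apply_apply,
        Complex.inner, Complex.inner, map_mul]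
      congr 1
      ring
    rw [h, real_inner_self_eq_norm_sq] at e1
    simpa using e1.symm
  have hFIoc : MemLp F 2 (volume.restrict (Ioc (0 : ℝ) 1)) := by
    rwa [← restrict_Ioo_eq_restrict_Ioc]
  have hsum := hasSum_sq_fourierCoeffOn zero_lt_one hFIoc
  have hzero : ∀ n, fourierCoeffOn zero_lt_one F n = 0 := by
    intro n
    rw [fourierCoeffOn_eq_integral, intervalIntegral.integral_of_le zero_le_one,
      integral_Ioc_eq_integral_Ioo]
    have : ∀ t : ℝ, fourier (-n) (t : AddCircle ((1 : ℝ) - 0)) • F t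
        = starRingEnd ℂ (wave n t) * F t := by
      intro t
      rw [fourier_coe_apply, wave, ← Complex.exp_conj, smul_eq_mul]
      congr 2
      simp only [freq, map_mul, map_ofNat, map_intCast, Complex.conj_ofReal, Complex.conj_I,
        sub_zero, Complex.ofReal_one, div_one, Int.cast_neg]
      ring
    simp only [this, hcoef n, smul_zero]
  simp only [hzero, norm_zero, ne_eq, OfNat.ofNat_ne_zero, not_false_eq_true, zero_pow] at hsum
  have hF0 := hsum.unique hasSum_zero
  rw [sub_zero, inv_one, one_smul, intervalIntegral.integral_of_le zero_le_one,
    integral_Ioc_eq_integral_Ioo] at hF0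
  have : inner ℝ f f = 0 := by
    rw [L2.inner_def, ← hF0]
    exact integral_congr_ae (ae_of_all _ fun t => by
      simp only [real_inner_self_eq_norm_sq, hFnorm])
  exact inner_self_eq_zero.1 this

/-- A path orthogonal in `H²_O` to all the circular paths vanishes: by integration by parts, the
inner product of `H²_O` with a circular path is a multiple of that of `L²`. -/
lemma eq_zero_of_forall_inner_circleH2O {u : H2O}
    (h : ∀ n z, inner ℝ (circleH2O n z) u = 0) : u = 0 := by
  obtain ⟨hw1, hw2, he0, he1⟩ := u.2
  have h01 : ∀ n z, inner ℝ (circleL2 n z) (u.1 1) = - inner ℝ (circleL2 n (freq n * z)) (u.1 0) :=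
    fun n z => by rw [hw1.inner_circleL2_freq_mul he0, neg_neg]
  have h12 : ∀ n z, inner ℝ (circleL2 n z) (u.1 2) = - inner ℝ (circleL2 n (freq n * z)) (u.1 1) :=
    fun n z => by rw [hw2.inner_circleL2_freq_mul he1, neg_neg]
  have hsq : ∀ n z, circleL2 n (freq n * (freq n * z))
      = (-(2 * Real.pi * n) ^ 2 : ℝ) • circleL2 n z := by
    intro n z
    rw [← map_smul, ← mul_assoc, ← sq, freq_sq, Complex.real_smul]
  have z0 : ∀ n z, inner ℝ (circleL2 n z) (u.1 0) = 0 := by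
    intro n z
    have hz := h n z
    have e : inner ℝ (circleH2O n z) u = ∑ i : Fin 3, inner ℝ ((circleH2O n z).1 i) (u.1 i) := by
      rw [Submodule.coe_inner, PiLp.inner_apply]
    rw [e, Fin.sum_univ_three] at hz
    simp only [circleH2O_apply, Fin.val_zero, Fin.val_one, Fin.val_two, pow_zero, pow_one, one_mul,
      sq (freq n), mul_assoc, h01, h12, hsq, real_inner_smul_left] at hz
    have hpos : 0 < 1 + (2 * Real.pi * n) ^ 2 + ((2 * Real.pi * n) ^ 2) ^ 2 := by positivity
    have hz' : (1 + (2 * Real.pi * n) ^ 2 + ((2 * Real.pi * n) ^ 2) ^ 2) *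
        inner ℝ (circleL2 n z) (u.1 0) = 0 := by linear_combination hz
    exact (mul_eq_zero.1 hz').resolve_left hpos.ne'
  have z1 : ∀ n z, inner ℝ (circleL2 n z) (u.1 1) = 0 := fun n z => by rw [h01, z0, neg_zero]
  have z2 : ∀ n z, inner ℝ (circleL2 n z) (u.1 2) = 0 := fun n z => by rw [h12, z1, neg_zero]
  ext1
  ext1 i
  fin_cases i
  · exact eq_zero_of_forall_inner_circleL2 z0
  · exact eq_zero_of_forall_inner_circleL2 z1
  · exact eq_zero_of_forall_inner_circleL2 z2

open scoped BoundedContinuousFunction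

/-! ### Rapidly converging series of circular paths -/

lemma summable_abs_pow_mul_half_pow (k : ℕ) :
    Summable fun n : ℤ => |(n : ℝ)| ^ k * (1 / 2 : ℝ) ^ n.natAbs := by
  have h := summable_pow_mul_geometric_of_norm_lt_one k (r := (1 / 2 : ℝ)) (by norm_num)
  apply Summable.of_nat_of_neg <;> simpa using h

/-- The sequence whose only non-zero term is `z`, at the place `n`. -/
def singleSeq (n : ℤ) (z : ℂ) : ℤ →ᵇ ℂ :=
  BoundedContinuousFunction.ofNormedAddCommGroupDiscrete (Pi.single n z) ‖z‖ fun m => by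
    rcases eq_or_ne m n with rfl | h
    · simp
    · simp [h]

lemma singleSeq_same (n : ℤ) (z : ℂ) : singleSeq n z n = z :=
  Pi.single_eq_same (M := fun _ : ℤ => ℂ) n z

lemma singleSeq_of_ne {n m : ℤ} (h : m ≠ n) (z : ℂ) : singleSeq n z m = 0 :=
  Pi.single_eq_of_ne (M := fun _ : ℤ => ℂ) h z

lemma norm_singleSeq_le (n : ℤ) (z : ℂ) : ‖singleSeq n z‖ ≤ ‖z‖ := by
  refine (BoundedContinuousFunction.norm_le (norm_nonneg z)).2 fun m => ?_
  rcases eq_or_ne m n with rfl | h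
  · rw [singleSeq_same]
  · rw [singleSeq_of_ne h, norm_zero]
    exact norm_nonneg z

/-- The map `w ↦ ∑ 2^{-|n|} E_n(w_n)` on the bounded sequences of complex numbers. -/
def weightedSeries {H : Type*} [NormedAddCommGroup H] [NormedSpace ℝ H] (E : ℤ → ℂ →L[ℝ] H) :
    (ℤ →ᵇ ℂ) →L[ℝ] H :=
  ∑' n : ℤ, ((1 / 2 : ℝ) ^ n.natAbs) • (E n ∘L BoundedContinuousFunction.evalCLM ℝ n)

lemma hasSum_weightedSeries_apply {H : Type*} [NormedAddCommGroup H] [NormedSpace ℝ H]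
    [CompleteSpace H] {E : ℤ → ℂ →L[ℝ] H}
    (hE : ∀ n, ‖E n‖ ≤ 1 + ‖freq n‖ + ‖freq n‖ ^ 2) (w : ℤ →ᵇ ℂ) :
    HasSum (fun n : ℤ => ((1 / 2 : ℝ) ^ n.natAbs) • E n (w n)) (weightedSeries E w) := by
  have hsum : Summable fun n : ℤ => ((1 / 2 : ℝ) ^ n.natAbs) •
      (E n ∘L (BoundedContinuousFunction.evalCLM ℝ n : (ℤ →ᵇ ℂ) →L[ℝ] ℂ)) := by
    have h0 := summable_abs_pow_mul_half_pow 0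
    have h1 := (summable_abs_pow_mul_half_pow 1).mul_left (2 * Real.pi)
    have h2 := (summable_abs_pow_mul_half_pow 2).mul_left ((2 * Real.pi) ^ 2)
    refine Summable.of_norm_bounded ((h0.add h1).add h2) fun n => ?_
    have heval : ‖(BoundedContinuousFunction.evalCLM ℝ n : (ℤ →ᵇ ℂ) →L[ℝ] ℂ)‖ ≤ 1 :=
      ContinuousLinearMap.opNorm_le_bound _ zero_le_one fun w => by
        simpa using w.norm_coe_le_norm n
    rw [norm_smul, norm_pow, Real.norm_of_nonneg (by norm_num : (0 : ℝ) ≤ 1 / 2)]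
    calc (1 / 2 : ℝ) ^ n.natAbs * ‖E n ∘L BoundedContinuousFunction.evalCLM ℝ n‖
        ≤ (1 / 2 : ℝ) ^ n.natAbs * ((1 + ‖freq n‖ + ‖freq n‖ ^ 2) * 1) := by
          gcongr
          refine (ContinuousLinearMap.opNorm_comp_le _ _).trans ?_
          gcongr
          exact hE n
      _ = _ := by
          rw [norm_freq]
          ring
  exact hsum.hasSum.mapL (ContinuousLinearMap.apply ℝ H w)

lemma denseRange_weightedSeries {H : Type*} [NormedAddCommGroup H] [InnerProductSpace ℝ H]
    [CompleteSpace H] {E : ℤ → ℂ →L[ℝ] H} (hE : ∀ n, ‖E n‖ ≤ 1 + ‖freq n‖ + ‖freq n‖ ^ 2)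
    (hE0 : ∀ u, (∀ n z, inner ℝ (E n z) u = 0) → u = 0) : DenseRange (weightedSeries E) := by
  have h : Dense ((weightedSeries E : (ℤ →ᵇ ℂ) →ₗ[ℝ] H).range : Set H) := by
    rw [Submodule.dense_iff_topologicalClosure_eq_top, Submodule.topologicalClosure_eq_top_iff,
      Submodule.eq_bot_iff]
    intro u hu
    refine hE0 u fun n z => ?_
    have h1 : weightedSeries E (singleSeq n z) = ((1 / 2 : ℝ) ^ n.natAbs) • E n z := by
      rw [← (hasSum_weightedSeries_apply hE (singleSeq n z)).tsum_eq, tsum_eq_single n,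
        singleSeq_same]
      intro m hm
      rw [singleSeq_of_ne hm, map_zero, smul_zero]
    have h2 := (Submodule.mem_orthogonal _ _).1 hu _ ⟨singleSeq n z, h1⟩
    rw [real_inner_smul_left] at h2
    exact (mul_eq_zero.1 h2).resolve_left (by positivity)
  exact h

/-- The map which sends a bounded sequence `w` of complex numbers to the path
`t ↦ ∑ 2^{-|n|} w_n e^{2πint}`. -/
def seriesCLM : (ℤ →ᵇ ℂ) →L[ℝ] H2O := weightedSeries circleH2O

lemma hasSum_seriesCLM_apply (w : ℤ →ᵇ ℂ) :
    HasSum (fun n : ℤ => ((1 / 2 : ℝ) ^ n.natAbs) • circleH2O n (w n)) (seriesCLM w) :=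
  hasSum_weightedSeries_apply norm_circleH2O_le w

lemma denseRange_seriesCLM : DenseRange seriesCLM :=
  denseRange_weightedSeries norm_circleH2O_le fun _ => eq_zero_of_forall_inner_circleH2O

/-- The sum of the series `∑ 2^{-|n|} w_n e^{2πint}`. -/
def waveSeries (w : ℤ →ᵇ ℂ) (t : ℝ) : ℂ := ∑' n : ℤ, ((1 / 2 : ℝ) ^ n.natAbs) • (w n * wave n t)

lemma summable_waveSeries (w : ℤ →ᵇ ℂ) (t : ℝ) :
    Summable fun n : ℤ => ((1 / 2 : ℝ) ^ n.natAbs) • (w n * wave n t) := by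
  refine Summable.of_norm_bounded ((summable_abs_pow_mul_half_pow 0).mul_left ‖w‖) fun n => ?_
  rw [norm_smul, norm_mul, norm_wave, norm_pow, Real.norm_of_nonneg (by norm_num : (0 : ℝ) ≤ 1 / 2),
    mul_one, pow_zero, one_mul, mul_comm]
  gcongr
  exact w.norm_coe_le_norm n

lemma toPlane_waveSeries (w : ℤ →ᵇ ℂ) (t : ℝ) :
    toPlane (waveSeries w t) = ∑' n : ℤ, ((1 / 2 : ℝ) ^ n.natAbs) • circlePath n (w n) t := by
  have := (toPlane : ℂ ≃L[ℝ] Plane).toContinuousLinearMap.map_tsum (summable_waveSeries w t)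
  refine this.trans (tsum_congr fun n => ?_)
  exact map_smul toPlane _ _

lemma contDiff_toPlane_waveSeries (w : ℤ →ᵇ ℂ) :
    ContDiff ℝ ∞ fun t => toPlane (waveSeries w t) := by
  simp only [toPlane_waveSeries]
  refine contDiff_tsum (N := ⊤) (v := fun k (n : ℤ) =>
    ((2 * Real.pi) ^ k * ‖w‖) * (|(n : ℝ)| ^ k * (1 / 2 : ℝ) ^ n.natAbs))
    (fun n => (contDiff_circlePath n (w n)).const_smul ((1 / 2 : ℝ) ^ n.natAbs))
    (fun k _ => (summable_abs_pow_mul_half_pow k).mul_left _) fun k n t _ => ?_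
  have h1 : iteratedDeriv k (fun t => ((1 / 2 : ℝ) ^ n.natAbs) • circlePath n (w n) t) t
      = ((1 / 2 : ℝ) ^ n.natAbs) • iteratedDeriv k (circlePath n (w n)) t :=
    iteratedDeriv_fun_const_smul_field _ _
  rw [norm_iteratedFDeriv_eq_norm_iteratedDeriv, h1, norm_smul, iteratedDeriv_circlePath,
    norm_circlePath, norm_mul, norm_pow, norm_pow, norm_freq,
    Real.norm_of_nonneg (by norm_num : (0 : ℝ) ≤ 1 / 2)]
  have := w.norm_coe_le_norm n
  calc (1 / 2 : ℝ) ^ n.natAbs * ((2 * Real.pi * |(n : ℝ)|) ^ k * ‖w n‖)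
      ≤ (1 / 2 : ℝ) ^ n.natAbs * ((2 * Real.pi * |(n : ℝ)|) ^ k * ‖w‖) := by gcongr
    _ = _ := by ring

lemma jetCLM_circleH2O_fst_apply (n : ℤ) (z : ℂ) (t : Icc (0 : ℝ) 1) :
    (jetCLM (circleH2O n z)).1 t = circlePath n z t := by
  have h1 : (jetCLM (circleH2O n z)).1.extend =ᵐ[volume.restrict (Icc 0 1)] circlePath n z := by
    rw [← restrict_Ioo_eq_restrict_Icc]
    refine (ae_eq_extend_fst_jetCLM _).symm.trans ?_
    rw [circleH2O_apply]
    simpa using coeFn_circleL2 n z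
  have h2 := Measure.eqOn_Icc_of_ae_eq volume zero_ne_one h1
    (UnitMap.continuous_extend _).continuousOn (continuous_circlePath n z).continuousOn t.2
  rwa [UnitMap.extend, projIcc_val] at h2

/-- The path represented by `seriesCLM w` is the sum of the series. -/
lemma ae_eq_toPlane_waveSeries (w : ℤ →ᵇ ℂ) :
    (seriesCLM w).1 0 =ᵐ[unitMeasure] fun t => toPlane (waveSeries w t) := by
  refine (ae_eq_extend_fst_jetCLM _).trans ?_
  filter_upwards [ae_restrict_mem measurableSet_Ioo] with t ht
  set t' : Icc (0 : ℝ) 1 := ⟨t, Ioo_subset_Icc_self ht⟩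
  have hev := (hasSum_seriesCLM_apply w).mapL
    (ContinuousMap.evalCLM ℝ t' ∘L ContinuousLinearMap.fst ℝ (UnitMap Plane) (UnitMap Plane) ∘L
      jetCLM)
  rw [UnitMap.extend, projIcc_of_mem zero_le_one (Ioo_subset_Icc_self ht), toPlane_waveSeries]
  refine hev.tsum_eq.symm.trans (tsum_congr fun n => ?_)
  rw [map_smul]
  exact congrArg _ (jetCLM_circleH2O_fst_apply n (w n) t')

/-! ### Injectivity near a circle -/

lemma norm_zpow_sub_zpow_le {a b : ℂ} (ha : ‖a‖ = 1) (hb : ‖b‖ = 1) (n : ℤ) :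
    ‖a ^ n - b ^ n‖ ≤ |(n : ℝ)| * ‖a - b‖ := by
  have hnat : ∀ k : ℕ, ‖a ^ k - b ^ k‖ ≤ k * ‖a - b‖ := by
    intro k
    induction k with
    | zero => simp
    | succ k ih =>
      have e : a ^ (k + 1) - b ^ (k + 1) = a ^ k * (a - b) + (a ^ k - b ^ k) * b := by ring
      rw [e]
      refine (norm_add_le _ _).trans ?_
      rw [norm_mul, norm_mul, norm_pow, ha, hb, one_pow]
      push_cast
      linarith
  have ha0 : a ≠ 0 := norm_ne_zero_iff.1 (by rw [ha]; exact one_ne_zero)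
  have hb0 : b ≠ 0 := norm_ne_zero_iff.1 (by rw [hb]; exact one_ne_zero)
  obtain ⟨k, rfl | rfl⟩ := n.eq_nat_or_neg
  · simpa using hnat k
  · have e : a ^ (-(k : ℤ)) - b ^ (-(k : ℤ))
        = (a ^ k)⁻¹ * (b ^ k - a ^ k) * (b ^ k)⁻¹ := by
      rw [zpow_neg, zpow_neg, zpow_natCast, zpow_natCast]
      field_simp
    rw [e, norm_mul, norm_mul, norm_inv, norm_inv, norm_pow, norm_pow, ha, hb, norm_sub_rev]
    simpa using hnat k

/-- The sum of the series is one-to-one on a period when the term of order one dominates the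
Lipschitz constants of the others. -/
lemma injOn_waveSeries {δ r : ℝ} (hδ : 0 < δ)
    (hr : r * ∑' n : ℤ, |(n : ℝ)| * (1 / 2 : ℝ) ^ n.natAbs < δ / 2) {w : ℤ →ᵇ ℂ}
    (hw : ‖w - singleSeq 1 δ‖ < r) : InjOn (waveSeries w) (Ico 0 1) := by
  intro s hs t ht hst
  have hsum := summable_abs_pow_mul_half_pow 1
  simp only [pow_one] at hsum
  have hdiff := (summable_waveSeries w s).hasSum.sub (summable_waveSeries w t).hasSum
  have hsingle : HasSum (fun n : ℤ => ((1 / 2 : ℝ) ^ n.natAbs) •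
      (singleSeq 1 (δ : ℂ) n * (wave n s - wave n t)))
      ((1 / 2 : ℝ) • ((δ : ℂ) * (wave 1 s - wave 1 t))) := by
    convert hasSum_single (f := fun n : ℤ => ((1 / 2 : ℝ) ^ n.natAbs) •
      (singleSeq 1 (δ : ℂ) n * (wave n s - wave n t))) 1 (fun n hn => ?_) using 1
    · simp [singleSeq_same]
    · simp only [singleSeq_of_ne hn, zero_mul, smul_zero]
  -- If `s` and `t` have the same image, the terms other than the dominant one sum to its opposite.
  have hrest := hdiff.sub hsingle
  rw [show ∑' n : ℤ, ((1 / 2 : ℝ) ^ n.natAbs) • (w n * wave n s)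
    = ∑' n : ℤ, ((1 / 2 : ℝ) ^ n.natAbs) • (w n * wave n t) from hst, sub_self, zero_sub] at hrest
  have hle : ‖-((1 / 2 : ℝ) • ((δ : ℂ) * (wave 1 s - wave 1 t)))‖ ≤
      r * ‖wave 1 s - wave 1 t‖ * ∑' n : ℤ, |(n : ℝ)| * (1 / 2 : ℝ) ^ n.natAbs := by
    rw [← hrest.tsum_eq]
    refine tsum_of_norm_bounded (hsum.hasSum.mul_left (r * ‖wave 1 s - wave 1 t‖)) fun n => ?_
    have e : ((1 / 2 : ℝ) ^ n.natAbs) • (w n * wave n s) -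
        ((1 / 2 : ℝ) ^ n.natAbs) • (w n * wave n t) -
        ((1 / 2 : ℝ) ^ n.natAbs) • (singleSeq 1 (δ : ℂ) n * (wave n s - wave n t))
        = ((1 / 2 : ℝ) ^ n.natAbs) • ((w - singleSeq 1 (δ : ℂ)) n * (wave n s - wave n t)) := by
      rw [← smul_sub, ← smul_sub, BoundedContinuousFunction.sub_apply]
      congr 1
      ring
    rw [e, norm_smul, norm_mul, norm_pow, Real.norm_of_nonneg (by norm_num : (0 : ℝ) ≤ 1 / 2)]
    have h1 : ‖(w - singleSeq 1 (δ : ℂ)) n‖ ≤ r :=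
      ((w - singleSeq 1 (δ : ℂ)).norm_coe_le_norm n).trans hw.le
    have h2 : ‖wave n s - wave n t‖ ≤ |(n : ℝ)| * ‖wave 1 s - wave 1 t‖ := by
      rw [wave_eq_zpow n s, wave_eq_zpow n t]
      exact norm_zpow_sub_zpow_le (norm_wave 1 s) (norm_wave 1 t) n
    have h3 : 0 ≤ r := (norm_nonneg _).trans hw.le
    calc (1 / 2 : ℝ) ^ n.natAbs * (‖(w - singleSeq 1 (δ : ℂ)) n‖ * ‖wave n s - wave n t‖)
        ≤ (1 / 2 : ℝ) ^ n.natAbs * (r * (|(n : ℝ)| * ‖wave 1 s - wave 1 t‖)) := by gcongr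
      _ = _ := by ring
  rw [norm_neg, norm_smul, norm_mul, Complex.norm_real, Real.norm_of_nonneg hδ.le,
    Real.norm_of_nonneg (by norm_num : (0 : ℝ) ≤ 1 / 2)] at hle
  have hzero : ‖wave 1 s - wave 1 t‖ = 0 := by
    by_contra hne
    have hpos : 0 < ‖wave 1 s - wave 1 t‖ := lt_of_le_of_ne (norm_nonneg _) (Ne.symm hne)
    have := mul_lt_mul_of_pos_right hr hpos
    linarith
  obtain ⟨k, hk⟩ := wave_one_eq_iff.1 (sub_eq_zero.1 (norm_eq_zero.1 hzero))
  have hk0 : k = 0 := by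
    have h1 : (k : ℝ) < 1 := by linarith [hs.2, ht.1]
    have h2 : (-1 : ℝ) < k := by linarith [hs.1, ht.2]
    have h1' : k < 1 := by exact_mod_cast h1
    have h2' : -1 < k := by exact_mod_cast h2
    omega
  rw [hk, hk0, Int.cast_zero, add_zero]

lemma isSmoothSimpleClosed_seriesCLM {δ r : ℝ} (hδ : 0 < δ)
    (hr : r * ∑' n : ℤ, |(n : ℝ)| * (1 / 2 : ℝ) ^ n.natAbs < δ / 2) {w : ℤ →ᵇ ℂ}
    (hw : ‖w - singleSeq 1 δ‖ < r) : IsSmoothSimpleClosed (seriesCLM w) := by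
  refine ⟨fun t => toPlane (waveSeries w t), contDiff_toPlane_waveSeries w, fun t => ?_,
    fun s hs t ht h => injOn_waveSeries hδ hr hw hs ht (toPlane.injective h),
    ae_eq_toPlane_waveSeries w⟩
  simp only [waveSeries, wave_add_one]

/-- Near a small circle there is an open set of sequences whose paths are simple and small. -/
lemma exists_ball_isSmoothSimpleClosed {η : ℝ} (hη : 0 < η) :
    ∃ (w₀ : ℤ →ᵇ ℂ) (r : ℝ), 0 < r ∧ ∀ w ∈ Metric.ball w₀ r,
      IsSmoothSimpleClosed (seriesCLM w) ∧ ‖seriesCLM w‖ ≤ η := by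
  set A : ℝ := ∑' n : ℤ, |(n : ℝ)| * (1 / 2 : ℝ) ^ n.natAbs
  have hA : 0 ≤ A := tsum_nonneg fun n => by positivity
  have hT := norm_nonneg seriesCLM
  set δ : ℝ := η / (2 * (‖seriesCLM‖ + 1)) with hδ
  have hδ0 : 0 < δ := by positivity
  have hr0 : 0 < δ / (2 * (A + 1)) := by positivity
  refine ⟨singleSeq 1 δ, δ / (2 * (A + 1)), hr0, fun w hw => ?_⟩
  rw [mem_ball_iff_norm] at hw
  refine ⟨isSmoothSimpleClosed_seriesCLM hδ0 ?_ hw, ?_⟩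
  · rw [div_mul_eq_mul_div, div_lt_div_iff₀ (by positivity) (by norm_num)]
    nlinarith
  · have h1 : ‖w‖ ≤ 2 * δ := by
      calc ‖w‖ = ‖(w - singleSeq 1 (δ : ℂ)) + singleSeq 1 (δ : ℂ)‖ := by rw [sub_add_cancel]
        _ ≤ δ / (2 * (A + 1)) + ‖(δ : ℂ)‖ :=
          (norm_add_le _ _).trans (add_le_add hw.le (norm_singleSeq_le _ _))
        _ ≤ δ + δ := by
          rw [Complex.norm_real, Real.norm_of_nonneg hδ0.le]
          gcongr
          exact div_le_self hδ0.le (by linarith)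
        _ = 2 * δ := by ring
    calc ‖seriesCLM w‖ ≤ ‖seriesCLM‖ * ‖w‖ := seriesCLM.le_opNorm w
      _ ≤ (‖seriesCLM‖ + 1) * (2 * δ) := by gcongr; linarith
      _ = η := by rw [hδ]; field_simp

/-! ### Generic tilts of the energy -/

lemma secondCountableTopology_H2O : SecondCountableTopology H2O := by
  have : Fact ((2 : ENNReal) ≠ ⊤) := ⟨by simp⟩
  have : SecondCountableTopology L2Path := inferInstance
  have : SecondCountableTopology (PiLp 2 fun _ : Fin 3 => L2Path) := inferInstance
  exact TopologicalSpace.Subtype.secondCountableTopology _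

lemma exists_isSmoothSimpleClosed_forall_hasInvertibleHessian (P Q : MvPolynomial (Fin 2) ℝ)
    {ε η : ℝ} (hε : 0 < ε) (hη : 0 < η) :
    ∃ v : H2O, IsSmoothSimpleClosed v ∧ ‖v‖ ≤ η ∧
      ∀ u, IsCriticalPoint (energy P Q ε v) u → HasInvertibleHessian (energy P Q ε v) u := by
  have := secondCountableTopology_H2O
  obtain ⟨w₀, r, hr, hball⟩ := exists_ball_isSmoothSimpleClosed hη
  obtain ⟨w, hw, hwb⟩ := (dense_setOf_hasInvertibleHessian_tiltedEnergy seriesCLM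
    denseRange_seriesCLM isCompactOperator_jetCLM (contDiff_jetEnergy P Q) hε).exists_mem_open
    Metric.isOpen_ball ⟨w₀, Metric.mem_ball_self hr⟩
  exact ⟨seriesCLM w, (hball w hwb).1, (hball w hwb).2, by rwa [energy_eq_tiltedEnergy]⟩

end PeriodicPaths

end

theorem mainTheorem5 (P Q : MvPolynomial (Fin 2) ℝ) (K : ℝ) (hK : 0 < K) :
    ∃ v : ℝ → PeriodicPaths.H2O,
      (∀ ε : ℝ, 0 < ε →
        PeriodicPaths.IsSmoothSimpleClosed (v ε) ∧
        ‖v ε‖ ≤ K * ε ∧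
        (∀ u, 0 ≤ PeriodicPaths.energy P Q ε (v ε) u) ∧
        PeriodicPaths.IsCoercive (PeriodicPaths.energy P Q ε (v ε)) ∧
        ContDiff ℝ 2 (PeriodicPaths.energy P Q ε (v ε)) ∧
        PeriodicPaths.PalaisSmale (PeriodicPaths.energy P Q ε (v ε)) ∧
        (∀ u, PeriodicPaths.IsCriticalPoint (PeriodicPaths.energy P Q ε (v ε)) u →
          PeriodicPaths.HasInvertibleHessian (PeriodicPaths.energy P Q ε (v ε)) u) ∧
        (∀ α : ℝ, {u | PeriodicPaths.IsCriticalPoint (PeriodicPaths.energy P Q ε (v ε)) u ∧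
          PeriodicPaths.energy P Q ε (v ε) u ≤ α}.Finite)) ∧
      Tendsto (fun ε => ‖v ε‖) (𝓝[>] 0) (𝓝 0) := by
  have hex : ∀ ε : ℝ, ∃ v : PeriodicPaths.H2O, 0 < ε →
      PeriodicPaths.IsSmoothSimpleClosed v ∧ ‖v‖ ≤ K * ε ∧
        ∀ u, PeriodicPaths.IsCriticalPoint (PeriodicPaths.energy P Q ε v) u →
          PeriodicPaths.HasInvertibleHessian (PeriodicPaths.energy P Q ε v) u := by
    intro ε
    by_cases hε : 0 < ε
    · obtain ⟨v, hv⟩ :=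
        PeriodicPaths.exists_isSmoothSimpleClosed_forall_hasInvertibleHessian P Q hε (mul_pos hK hε)
      exact ⟨v, fun _ => hv⟩
    · exact ⟨0, fun h => absurd h hε⟩
  choose v hv using hex
  refine ⟨v, fun ε hε => ?_, ?_⟩
  · obtain ⟨h1, h2, h3⟩ := hv ε hε
    have hpos := PeriodicPaths.jetEnergy_nonneg P Q
    have hsm := PeriodicPaths.contDiff_jetEnergy P Q (n := 2)
    have hcd : ContDiff ℝ 2 (PeriodicPaths.energy P Q ε (v ε)) := by
      rw [PeriodicPaths.energy_eq_tiltedEnergy]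
      exact PeriodicPaths.contDiff_tiltedEnergy hsm _
    have hps : PeriodicPaths.PalaisSmale (PeriodicPaths.energy P Q ε (v ε)) := by
      rw [PeriodicPaths.energy_eq_tiltedEnergy]
      exact PeriodicPaths.palaisSmale_tiltedEnergy PeriodicPaths.isCompactOperator_jetCLM hsm hpos
        hε _
    refine ⟨h1, h2, ?_, ?_, hcd, hps, h3, hps.finite_criticalPoints hcd h3⟩
    · rw [PeriodicPaths.energy_eq_tiltedEnergy]
      exact PeriodicPaths.tiltedEnergy_nonneg hε hpos _
    · rw [PeriodicPaths.energy_eq_tiltedEnergy]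
      exact PeriodicPaths.isCoercive_tiltedEnergy hε hpos _
  · have hlim : Tendsto (fun ε : ℝ => K * ε) (𝓝[>] 0) (𝓝 0) := by
      have : Tendsto (fun ε : ℝ => K * ε) (𝓝 0) (𝓝 (K * 0)) :=
        (continuous_const.mul continuous_id).tendsto 0
      rw [mul_zero] at this
      exact this.mono_left nhdsWithin_le_nhds
    refine tendsto_of_tendsto_of_tendsto_of_le_of_le' tendsto_const_nhds hlim
      (Eventually.of_forall fun _ => norm_nonneg _) ?_
    filter_upwards [self_mem_nhdsWithin] with ε hε
    exact (hv ε hε).2.1
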